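/- Let $h:\mathbb R^n\to\mathbb R$ be convex and piecewise linear-quadratic (i.e. $\mathbb R^n$ is a finite union of polyhedra on each of which $h$ is a polynomial of degree at most two), for instance the rank loss $h(u)=\frac{2}{n(n-1)}\sum_{i<j}|u_i-u_j|$. Let $A\in\mathbb R^{n\times p}$, $b\in\mathbb R^n$, $\lambda>0$, $\sigma_k>0$, $x^k\in\mathbb R^p$, and put $f(z)=\lambda\|z\|_1$. Consider the problem $$(P)\qquad \min_{x,u,z}\ h(u)+f(z)+\tfrac1{2\sigma_k}\|x-x^k\|^2\quad\text{s.t. } u=b-Ax,\ z=x .$$ For $\alpha=(\alpha_1,\alpha_2)\in\mathbb R^n\times\mathbb R^p$ let $$\mathcal L_k(x,u,z;\alpha)=h(u)+f(z)-\langle u-b+Ax,\alpha_1\rangle-\langle z-x,\alpha_2\rangle+\tfrac1{2\sigma_k}\|x-x^k\|^2,$$ $$L_\rho(x,u,z,\alpha)=\mathcal L_k(x,u,z;\alpha)+\tfrac\rho2\|u-b+Ax\|^2+\tfrac\rho2\|z-x\|^2 .$$ The dual problem is $\max_\alpha -\phi(\alpha)$ with $$\phi(\alpha)=\tfrac{\sigma_k}2\|A^\top\alpha_1-\alpha_2\|^2-\langle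 b,\alpha_1\rangle+\langle x^k,A^\top\alpha_1-\alpha_2\rangle+h^*(\alpha_1)+f^*(\alpha_2),$$ where $h^*,f^*$ are the conjugate functions; $\Omega$ denotes its set of optimal solutions. Let $\mathcal T_\phi=\partial\phi$ and $\mathcal T_{\mathcal L_k}(x,u,z,\alpha)=\{(x',u',z',\alpha'):(x',u',z',-\alpha')\in\partial\mathcal L_k(x,u,z,\alpha)\}$ (the subdifferential of the convex-concave function $\mathcal L_k$). A set-valued map $\mathcal T$ satisfies the error bound condition at the origin with modulus $a\ge0$ if there is $\varepsilon>0$ such that $\mathrm{dist}(w,\mathcal T^{-1}(0))\le a\,\mathrm{dist}(0,\mathcal T(w))$ for all $w$ with $\mathrm{dist}(0,\mathcal T(w))<\varepsilon$. Let $M_q(x)=\min_y\{q(y)+\frac12\|y-x\|^2\}$, with minimizer $\mathrm{Prox}_q(x)$. Let $\rho_j>0$ with $\rho_j\to\rho_\infty\in(0,+\infty]$, and let $\{(x^j,u^j,z^j,\alpha^j)\}$ be an infinite sequence generated by the augmented Lagrangian method: with $f_1(x)=b-Ax+\alpha_1^j/\rho_j$, $f_2(x)=x+\alpha_2^j/\rho_j$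 and $$\varphi_j(x)=\rho_jM_{h/\rho_j}(f_1(x))+\rho_jM_{f/\rho_j}(f_2(x))+\tfrac1{2\sigma_k}\|x-x^k\|^2,$$ the point $x^{j+1}$ is an approximate minimizer of $\varphi_j$ (in the sense of the stopping criteria below), $u^{j+1}=\mathrm{Prox}_{h/\rho_j}(f_1(x^{j+1}))$, $z^{j+1}=\mathrm{Prox}_{f/\rho_j}(f_2(x^{j+1}))$ and $\alpha^{j+1}=\alpha^j-\rho_j\,(u^{j+1}-b+Ax^{j+1},\ z^{j+1}-x^{j+1})$. The stopping criteria are $$\text{(D1)}\quad L_{\rho_j}(x^{j+1},u^{j+1},z^{j+1},\alpha^j)-\inf_{x,u,z} L_{\rho_j}(x,u,z,\alpha^j)\le\tfrac{\kappa_j^2}{2\rho_j}\|\alpha^{j+1}-\alpha^j\|^2,\quad \kappa_j\ge0,\ \sum_j\kappa_j<\infty,$$ $$\text{(D2)}\quad \|\nabla\varphi_j(x^{j+1})\|\le\tfrac{\kappa_j'}{\rho_j}\|\alpha^{j+1}-\alpha^j\|,\quad 0\le\kappa_j'\to0 .$$ **Theorem.** Suppose that (D1) holds for all $j$. Then $\mathcal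 T_\phi$ and $\mathcal T_{\mathcal L_k}$ satisfy the error bound condition at the origin with some moduli, and: (i) $\{\alpha^j\}$ converges to some $\alpha^*\in\Omega$. For every modulus $a_\phi$ of the error bound condition of $\mathcal T_\phi$, for all sufficiently large $j$, $$\mathrm{dist}(\alpha^{j+1},\Omega)\le\theta_j\,\mathrm{dist}(\alpha^j,\Omega),\qquad \theta_j=\frac{a_\phi}{\sqrt{a_\phi^2+\rho_j^2}}+\frac{2\kappa_j}{1-\kappa_j},$$ and $\theta_j\to\theta_\infty=a_\phi(a_\phi^2+\rho_\infty^2)^{-1/2}<1$ ($\theta_\infty=0$ if $\rho_\infty=\infty$). (ii) $(P)$ has a unique optimal solution $(x^*,u^*,z^*)$. If (D2) also holds for all $j$, then for every modulus $a_{\mathcal L_k}$ of the error bound condition of $\mathcal T_{\mathcal L_k}$, for all sufficiently large $j$, $$\|(x^{j+1},u^{j+1},z^{j+1})-(x^*,u^*,z^*)\|\le\theta_j'\,\|\alpha^{j+1}-\alpha^j\|,\qquad \theta_j'=\frac{a_{\mathcal L_k}(1+\kappa_j')}{\rho_j},$$ and $\theta_j'\to a_{\mathcal L_k}/\rho_\infty$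 (which is $0$ if $\rho_\infty=\infty$). -/

import Mathlib

open Filter Topology
open scoped InnerProductSpace ENNReal

noncomputable section

/-! ### Convex-analytic notions -/

/-- The convex subdifferential of an extended-real-valued function. -/
def subdifferential {E : Type*} [NormedAddCommGroup E] [InnerProductSpace ℝ E]
    (f : E → EReal) (x : E) : Set E :=
  {v | f x ≠ ⊤ ∧ ∀ y, f x + ((⟪v, y - x⟫_ℝ : ℝ) : EReal) ≤ f y}

/-- The conjugate function `f*(v) = sup_u (⟨v, u⟩ - f u)` of a real-valued function. -/
def conjugateFun {E : Type*} [NormedAddCommGroup E] [InnerProductSpace ℝ E]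
    (f : E → ℝ) (v : E) : EReal :=
  ⨆ u, ((⟪v, u⟫_ℝ - f u : ℝ) : EReal)

/-- The Moreau-Yosida regularization `M_q(x) = min_y (q y + ‖y - x‖² / 2)`. -/
def moreauEnvelope {E : Type*} [NormedAddCommGroup E] (q : E → ℝ) (x : E) : ℝ :=
  ⨅ y, (q y + (1 / 2) * ‖y - x‖ ^ 2)

/-- `P = Prox_q(x)`: `P` is a (hence, for convex `q`, the unique) minimizer of
`y ↦ q y + ‖y - x‖² / 2`. -/
def IsProx {E : Type*} [NormedAddCommGroup E] (q : E → ℝ) (x P : E) : Prop :=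
  ∀ y, q P + (1 / 2) * ‖P - x‖ ^ 2 ≤ q y + (1 / 2) * ‖y - x‖ ^ 2

/-- A polyhedral set: the solution set of finitely many linear inequalities. -/
def IsPolyhedralSet {E : Type*} [NormedAddCommGroup E] [InnerProductSpace ℝ E]
    (C : Set E) : Prop :=
  ∃ (m : ℕ) (g : Fin m → E) (β : Fin m → ℝ), C = {x | ∀ i, ⟪g i, x⟫_ℝ ≤ β i}

/-- A (finite-valued) piecewise linear-quadratic function: the whole space is a finite union of
polyhedral sets, on each of which the function is a polynomial of degree at most two. -/
def IsPiecewiseLinearQuadratic {E : Type*} [NormedAddCommGroup E] [InnerProductSpace ℝ E]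
    (f : E → ℝ) : Prop :=
  ∃ (m : ℕ) (C : Fin m → Set E),
    (∀ i, IsPolyhedralSet (C i)) ∧ (⋃ i, C i) = Set.univ ∧
    ∀ i, ∃ (Q : E →L[ℝ] E) (c : E) (r : ℝ),
      ∀ x ∈ C i, f x = (1 / 2) * ⟪x, Q x⟫_ℝ + ⟪c, x⟫_ℝ + r

/-- The set-valued map `T` satisfies the error bound condition at the origin with modulus `a ≥ 0`:
for some `ε > 0`, `dist(x, T⁻¹(0)) ≤ a dist(0, T x)` whenever `dist(0, T x) < ε`.
Distances are extended, so that the distance to the empty set is `∞`. -/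
def HasErrorBoundAtOrigin {E : Type*} [NormedAddCommGroup E] (T : E → Set E) (a : ℝ) : Prop :=
  0 ≤ a ∧ ∃ ε : ℝ, 0 < ε ∧ ∀ x : E,
    Metric.infEDist (0 : E) (T x) < ENNReal.ofReal ε →
      Metric.infEDist x {q | (0 : E) ∈ T q} ≤
        ENNReal.ofReal a * Metric.infEDist (0 : E) (T x)

/-! ### The proximal point subproblem and its augmented Lagrangian -/

/-- The variables `(x, u, z) ∈ ℝᵖ × ℝⁿ × ℝᵖ`, with the Euclidean norm. -/
abbrev PrimalSpace (n p : ℕ) : Type :=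
  WithLp 2 (EuclideanSpace ℝ (Fin p) ×
    WithLp 2 (EuclideanSpace ℝ (Fin n) × EuclideanSpace ℝ (Fin p)))

/-- The multipliers `α = (α₁, α₂) ∈ ℝⁿ × ℝᵖ`, with the Euclidean norm. -/
abbrev DualSpace (n p : ℕ) : Type :=
  WithLp 2 (EuclideanSpace ℝ (Fin n) × EuclideanSpace ℝ (Fin p))

/-- The triple `(x, u, z)`. -/
def primalPt {n p : ℕ} (x : EuclideanSpace ℝ (Fin p)) (u : EuclideanSpace ℝ (Fin n))
    (z : EuclideanSpace ℝ (Fin p)) : PrimalSpace n p :=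
  WithLp.toLp 2 (x, WithLp.toLp 2 (u, z))

/-- The data of the problem
`min h(u) + λ ‖z‖₁ + ‖x - xₖ‖² / (2 σₖ)` subject to `u = b - A x`, `z = x`. -/
structure ProxSubproblem (n p : ℕ) where
  h : EuclideanSpace ℝ (Fin n) → ℝ
  A : EuclideanSpace ℝ (Fin p) →L[ℝ] EuclideanSpace ℝ (Fin n)
  b : EuclideanSpace ℝ (Fin n)
  lam : ℝ
  sigma : ℝ
  xk : EuclideanSpace ℝ (Fin p)

namespace ProxSubproblem

variable {n p : ℕ} (D : ProxSubproblem n p)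

/-- `f(z) = λ ‖z‖₁`. -/
def f (z : EuclideanSpace ℝ (Fin p)) : ℝ := D.lam * ∑ i, |z i|

/-- The objective function of the subproblem. -/
def objective (x : EuclideanSpace ℝ (Fin p)) (u : EuclideanSpace ℝ (Fin n))
    (z : EuclideanSpace ℝ (Fin p)) : ℝ :=
  D.h u + D.f z + 1 / (2 * D.sigma) * ‖x - D.xk‖ ^ 2

/-- `(x, u, z)` is an optimal solution of the subproblem. -/
def IsOptimal (x : EuclideanSpace ℝ (Fin p)) (u : EuclideanSpace ℝ (Fin n))
    (z : EuclideanSpace ℝ (Fin p)) : Prop :=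
  (u = D.b - D.A x ∧ z = x) ∧
    ∀ x' u' z', u' = D.b - D.A x' → z' = x' → D.objective x u z ≤ D.objective x' u' z'

/-- The Lagrangian function of the subproblem. -/
def lagrangian (x : EuclideanSpace ℝ (Fin p)) (u : EuclideanSpace ℝ (Fin n))
    (z : EuclideanSpace ℝ (Fin p)) (α : DualSpace n p) : ℝ :=
  D.h u + D.f z - ⟪u - D.b + D.A x, α.fst⟫_ℝ - ⟪z - x, α.snd⟫_ℝ
    + 1 / (2 * D.sigma) * ‖x - D.xk‖ ^ 2

/-- The augmented Lagrangian function `L_ρ(x, u, z, α)` of the subproblem. -/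
def augLagrangian (ρ : ℝ) (x : EuclideanSpace ℝ (Fin p)) (u : EuclideanSpace ℝ (Fin n))
    (z : EuclideanSpace ℝ (Fin p)) (α : DualSpace n p) : ℝ :=
  D.h u + D.f z - ⟪u - D.b + D.A x, α.fst⟫_ℝ - ⟪z - x, α.snd⟫_ℝ
    + ρ / 2 * ‖u - D.b + D.A x‖ ^ 2 + ρ / 2 * ‖z - x‖ ^ 2
    + 1 / (2 * D.sigma) * ‖x - D.xk‖ ^ 2

/-- `φ`, the negative of the dual objective function. -/
def phi (α : DualSpace n p) : EReal :=
  ((D.sigma / 2 * ‖D.A.adjoint α.fst - α.snd‖ ^ 2 - ⟪D.b, α.fst⟫_ℝ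
      + ⟪D.xk, D.A.adjoint α.fst - α.snd⟫_ℝ : ℝ) : EReal)
    + conjugateFun D.h α.fst + conjugateFun D.f α.snd

/-- `Ω`, the set of optimal solutions of the dual problem `max_α -φ(α)`. -/
def dualSolutions : Set (DualSpace n p) :=
  {α | ∀ β, - D.phi β ≤ - D.phi α}

/-- `T_φ = ∂φ`. -/
def Tphi (α : DualSpace n p) : Set (DualSpace n p) :=
  subdifferential D.phi α

/-- `T_ℒ = {(x', u', z', α') | (x', u', z', -α') ∈ ∂ℒ(x, u, z, α)}`, where `∂ℒ` is the
subdifferential of the convex-concave function `ℒ`: the subdifferential in `(x, u, z)` times the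
superdifferential in `α`. -/
def Tlagrangian (q : WithLp 2 (PrimalSpace n p × DualSpace n p)) :
    Set (WithLp 2 (PrimalSpace n p × DualSpace n p)) :=
  {q' |
    q'.fst ∈ subdifferential
      (fun w : PrimalSpace n p =>
        ((D.lagrangian w.fst w.snd.fst w.snd.snd q.snd : ℝ) : EReal)) q.fst ∧
    q'.snd ∈ subdifferential
      (fun α : DualSpace n p =>
        ((- D.lagrangian q.fst.fst q.fst.snd.fst q.fst.snd.snd α : ℝ) : EReal)) q.snd}

/-- `f₁(x) = b - A x + α₁ / ρ`. -/
def f₁ (ρ : ℝ) (α : DualSpace n p) (x : EuclideanSpace ℝ (Fin p)) : EuclideanSpace ℝ (Fin n) :=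
  D.b - D.A x + (1 / ρ) • α.fst

/-- `f₂(x) = x + α₂ / ρ`. -/
def f₂ (_D : ProxSubproblem n p) (ρ : ℝ) (α : DualSpace n p) (x : EuclideanSpace ℝ (Fin p)) :
    EuclideanSpace ℝ (Fin p) :=
  x + (1 / ρ) • α.snd

/-- `φ_j(x) = ρ M_{h/ρ}(f₁(x)) + ρ M_{λ‖·‖₁/ρ}(f₂(x)) + ‖x - xₖ‖² / (2 σₖ)`, with `ρ = ρ_j` and
`α = α^j`: the function which the `j`-th step of the method minimizes. -/
def innerObjective (ρ : ℝ) (α : DualSpace n p) (x : EuclideanSpace ℝ (Fin p)) : ℝ :=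
  ρ * moreauEnvelope (fun u => 1 / ρ * D.h u) (D.f₁ ρ α x)
    + ρ * moreauEnvelope (fun z => 1 / ρ * D.f z) (D.f₂ ρ α x)
    + 1 / (2 * D.sigma) * ‖x - D.xk‖ ^ 2

/-- The sequences are generated by the augmented Lagrangian method with penalty parameters `ρ_j`:
`u^{j+1} = Prox_{h/ρ_j}(f₁(x^{j+1}))`, `z^{j+1} = Prox_{λ‖·‖₁/ρ_j}(f₂(x^{j+1}))` and
`α^{j+1} = α^j - ρ_j (u^{j+1} - b + A x^{j+1}, z^{j+1} - x^{j+1})`. How well `x^{j+1}` has to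
minimize `φ_j` is what the stopping criteria say. -/
structure IsALMSequence (ρ : ℕ → ℝ) (x : ℕ → EuclideanSpace ℝ (Fin p))
    (u : ℕ → EuclideanSpace ℝ (Fin n)) (z : ℕ → EuclideanSpace ℝ (Fin p))
    (α : ℕ → DualSpace n p) : Prop where
  u_step : ∀ j, IsProx (fun y => 1 / ρ j * D.h y) (D.f₁ (ρ j) (α j) (x (j + 1))) (u (j + 1))
  z_step : ∀ j, IsProx (fun y => 1 / ρ j * D.f y) (D.f₂ (ρ j) (α j) (x (j + 1))) (z (j + 1))
  α_step : ∀ j, α (j + 1) = α j - ρ j •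
    (WithLp.toLp 2 (u (j + 1) - D.b + D.A (x (j + 1)), z (j + 1) - x (j + 1)) : DualSpace n p)

/-- Stopping criterion (D1), with tolerances `κ_j`. -/
structure StoppingD1 (ρ : ℕ → ℝ) (x : ℕ → EuclideanSpace ℝ (Fin p))
    (u : ℕ → EuclideanSpace ℝ (Fin n)) (z : ℕ → EuclideanSpace ℝ (Fin p))
    (α : ℕ → DualSpace n p) (κ : ℕ → ℝ) : Prop where
  nonneg : ∀ j, 0 ≤ κ j
  summable : Summable κ
  bound : ∀ j,
    D.augLagrangian (ρ j) (x (j + 1)) (u (j + 1)) (z (j + 1)) (α j)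
        - (⨅ w : PrimalSpace n p, D.augLagrangian (ρ j) w.fst w.snd.fst w.snd.snd (α j))
      ≤ κ j ^ 2 / (2 * ρ j) * ‖α (j + 1) - α j‖ ^ 2

/-- Stopping criterion (D2), with tolerances `κ'_j`. -/
structure StoppingD2 (ρ : ℕ → ℝ) (x : ℕ → EuclideanSpace ℝ (Fin p))
    (α : ℕ → DualSpace n p) (κ' : ℕ → ℝ) : Prop where
  nonneg : ∀ j, 0 ≤ κ' j
  tendsto_zero : Tendsto κ' atTop (𝓝 0)
  bound : ∀ j, ‖gradient (D.innerObjective (ρ j) (α j)) (x (j + 1))‖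
    ≤ κ' j / ρ j * ‖α (j + 1) - α j‖

end ProxSubproblem

/-- `θ_∞ = a (a² + ρ_∞²)^{-1/2}`, understood as `0` if `ρ_∞ = ∞`. -/
def thetaLimit (a : ℝ) (ρinf : ℝ≥0∞) : ℝ :=
  if ρinf = ⊤ then 0 else a / √(a ^ 2 + ρinf.toReal ^ 2)

/-- `a / ρ_∞`, understood as `0` if `ρ_∞ = ∞`. -/
def thetaPrimeLimit (a : ℝ) (ρinf : ℝ≥0∞) : ℝ :=
  if ρinf = ⊤ then 0 else a / ρinf.toReal

end

/-! Write `w = (x, u, z)` and read the constraints as one linear equation `B w = b`. The augmented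
Lagrangian method is then the proximal point method for the dual. If `w` minimizes the augmented
Lagrangian exactly, the updated multiplier `β = α - ρ (B w - b)` satisfies `(α - β) / ρ ∈ ∂φ(β)`,
because `φ` is the supremum over `w` of the negative Lagrangians, which are affine in the multiplier
(`phi_eq`, `linLagrangian_le_of_isMin_aug`). Criterion (D1) bounds the distance from the computed
multiplier to `β` by `κ_j` times the step (`norm_sub_sq_le_of_isMin_aug`).

The error bounds come from polyhedrality. The graph of the subdifferential of a convex piecewise
linear-quadratic function is a finite union of polyhedra
(`ConvexOn.exists_polyhedral_subdifferential_graph`); hence so is the graph of the Lagrangian map,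
and Hoffman's lemma makes its inverse upper Lipschitz at the origin. This property passes to `∂φ`.
It also yields a saddle point: a quadratic penalty produces points whose residual in the Lagrangian
map is arbitrarily small, and near such a point there must be a zero.

For (i), monotonicity gives `‖β - ω‖² + ‖α - β‖² ≤ ‖α - ω‖²` for every dual solution `ω`. With
summable errors the distances to solutions are quasi-Fejér, so the steps vanish and the error bound
applies: `ρ dist(β, Ω) ≤ a ‖α - β‖`. Taking for `ω` the dual solution nearest to `α` and combining
the two estimates gives the factor `a / √(a² + ρ²)`; the inexactness adds the rest.

For (ii), the proximal formulas for `u` and `z` show that the iterate has in the Lagrangian map the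
residual formed by `∇φ_j(x)` and the constraint violation. Criterion (D2) makes it small, and the
error bound gives the distance to the saddle points. These all share one primal part because the
proximal term is strictly convex in `x`, which determines `u` and `z`. -/

/-! ### Polyhedral cones, Hoffman's lemma and upper Lipschitz inverses. -/

section PolyhedralGeometry

variable {E : Type*} [NormedAddCommGroup E] [InnerProductSpace ℝ E]

/-- Minkowski's theorem in dual form: a polyhedral cone contains finitely many vectors which
determine its polar. -/
theorem exists_finset_polar_generators [FiniteDimensional ℝ E] (S : Finset E) :
    ∃ R : Finset E, (∀ r ∈ R, ∀ g ∈ S, ⟪g, r⟫_ℝ ≤ 0) ∧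
      ∀ e : E, (∀ r ∈ R, ⟪e, r⟫_ℝ ≤ 0) → ∀ d : E, (∀ g ∈ S, ⟪g, d⟫_ℝ ≤ 0) → ⟪e, d⟫_ℝ ≤ 0 := by
  classical
  induction S using Finset.induction_on with
  | empty =>
    let b := stdOrthonormalBasis ℝ E
    refine ⟨Finset.univ.image (fun i => b i) ∪ Finset.univ.image (fun i => - b i), by simp, ?_⟩
    intro e he d _
    have h0 : ∀ i, ⟪e, b i⟫_ℝ = 0 := by
      intro i
      have h1 := he (b i) (by simp)
      have h2 := he (- b i) (by simp)
      rw [inner_neg_right] at h2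
      linarith
    have : ⟪e, d⟫_ℝ = ∑ i, ⟪e, b i⟫_ℝ * ⟪b i, d⟫_ℝ := (b.sum_inner_mul_inner e d).symm
    simp [this, h0]
  | insert g S _ ih =>
    obtain ⟨R, hR, hpol⟩ := ih
    -- Double description step: old generators on the good side of `g` are kept, and each bad one is
    -- combined with each good one so that the result is orthogonal to `g`.
    let comb : E × E → E := fun q => ⟪g, q.1⟫_ℝ • q.2 - ⟪g, q.2⟫_ℝ • q.1
    let Rp := R.filter (fun r => 0 < ⟪g, r⟫_ℝ)
    let Rm := R.filter (fun r => ⟪g, r⟫_ℝ ≤ 0)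
    refine ⟨Rm ∪ (Rp ×ˢ Rm).image comb, ?_, ?_⟩
    · intro r hr g' hg'
      rcases Finset.mem_union.1 hr with hr | hr
      · have hr' := Finset.mem_filter.1 hr
        rcases Finset.mem_insert.1 hg' with rfl | hg'
        · exact hr'.2
        · exact hR r hr'.1 g' hg'
      · obtain ⟨⟨r, s⟩, hrs, rfl⟩ := Finset.mem_image.1 hr
        obtain ⟨h1, h2⟩ := Finset.mem_product.1 hrs
        have h1' := Finset.mem_filter.1 h1
        have h2' := Finset.mem_filter.1 h2
        simp only [comb, inner_sub_right, inner_smul_right]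
        rcases Finset.mem_insert.1 hg' with rfl | hg'
        · apply le_of_eq; ring
        · have a1 := hR r h1'.1 g' hg'
          have a2 := hR s h2'.1 g' hg'
          simp only at *
          nlinarith [mul_nonneg h1'.2.le (neg_nonneg.2 a2),
            mul_nonneg (neg_nonneg.2 h2'.2) (neg_nonneg.2 a1)]
    · intro e he d hd
      have hm : ∀ s ∈ Rm, ⟪e, s⟫_ℝ ≤ 0 := fun s hs => he s (Finset.mem_union_left _ hs)
      have hc : ∀ r ∈ Rp, ∀ s ∈ Rm, ⟪g, r⟫_ℝ * ⟪e, s⟫_ℝ - ⟪g, s⟫_ℝ * ⟪e, r⟫_ℝ ≤ 0 := by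
        intro r hr s hs
        have := he (comb (r, s)) (Finset.mem_union_right _
          (Finset.mem_image_of_mem _ (Finset.mem_product.2 ⟨hr, hs⟩)))
        simpa [comb, inner_sub_right, inner_smul_right] using this
      -- It is enough to find a multiplier `t` for the new inequality: then `e - t • g` is in the
      -- polar of the old cone, and `⟪e, d⟫ ≤ t ⟪g, d⟫ ≤ 0`.
      suffices h : ∃ t : ℝ, 0 ≤ t ∧ ∀ r ∈ R, ⟪e, r⟫_ℝ ≤ t * ⟪g, r⟫_ℝ by
        obtain ⟨t, ht, h⟩ := h
        have h1 := hpol (e - t • g) (fun r hr => by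
          rw [inner_sub_left, real_inner_smul_left]; linarith [h r hr]) d
          (fun g' hg' => hd g' (Finset.mem_insert_of_mem hg'))
        rw [inner_sub_left, real_inner_smul_left] at h1
        have h2 := hd g (Finset.mem_insert_self _ _)
        nlinarith
      by_cases hpos : ∃ r ∈ Rp, 0 < ⟪e, r⟫_ℝ
      · obtain ⟨r1, hr1, hr1e⟩ := hpos
        -- The largest ratio is the least `t` that works on `Rp`. The combinations of its maximizer
        -- with `Rm` say that it also works on `Rm`.
        obtain ⟨r0, hr0, hmax⟩ := Finset.exists_max_image Rp (fun r => ⟪e, r⟫_ℝ / ⟪g, r⟫_ℝ) ⟨r1, hr1⟩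
        have hg0 : 0 < ⟪g, r0⟫_ℝ := (Finset.mem_filter.1 hr0).2
        have hg1 : 0 < ⟪g, r1⟫_ℝ := (Finset.mem_filter.1 hr1).2
        refine ⟨⟪e, r0⟫_ℝ / ⟪g, r0⟫_ℝ, (div_pos hr1e hg1).le.trans (hmax r1 hr1), ?_⟩
        intro r hr
        by_cases hrg : 0 < ⟪g, r⟫_ℝ
        · exact (div_le_iff₀ hrg).1 (hmax r (Finset.mem_filter.2 ⟨hr, hrg⟩))
        · have := hc r0 hr0 r (Finset.mem_filter.2 ⟨hr, not_lt.1 hrg⟩)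
          rw [div_mul_eq_mul_div, le_div_iff₀ hg0]
          linarith
      · push Not at hpos
        refine ⟨0, le_rfl, fun r hr => ?_⟩
        by_cases hrg : 0 < ⟪g, r⟫_ℝ
        · simpa using hpos r (Finset.mem_filter.2 ⟨hr, hrg⟩)
        · simpa using hm r (Finset.mem_filter.2 ⟨hr, not_lt.1 hrg⟩)

/-- A direction which does not increase the active constraints is feasible. -/
theorem exists_pos_step_feasible {ι : Type*} [Finite ι] {g : ι → E} {c : ι → ℝ} {p d : E}
    (hp : ∀ i, ⟪g i, p⟫_ℝ ≤ c i) (hd : ∀ i, ⟪g i, p⟫_ℝ = c i → ⟪g i, d⟫_ℝ ≤ 0) :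
    ∃ t : ℝ, 0 < t ∧ ∀ i, ⟪g i, p + t • d⟫_ℝ ≤ c i := by
  have h : ∀ᶠ t : ℝ in 𝓝[>] 0, ∀ i, ⟪g i, p + t • d⟫_ℝ ≤ c i := by
    rw [eventually_all]
    intro i
    rcases (hp i).lt_or_eq with hlt | heq
    · have hc : ContinuousAt (fun t : ℝ => ⟪g i, p + t • d⟫_ℝ) 0 := by fun_prop
      have := hc.eventually_lt (continuousAt_const (y := c i)) (by simpa using hlt)
      exact (this.filter_mono nhdsWithin_le_nhds).mono fun t ht => ht.le
    · filter_upwards [self_mem_nhdsWithin] with t ht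
      rw [inner_add_right, inner_smul_right, heq]
      have := mul_nonpos_of_nonneg_of_nonpos (le_of_lt ht) (hd i heq)
      linarith
  obtain ⟨t, h1, h2⟩ := (h.and self_mem_nhdsWithin).exists
  exact ⟨t, h2, h1⟩

/-- A vector in the polar of a polyhedral cone is controlled by the violated inequalities. -/
theorem exists_norm_le_of_mem_polar [FiniteDimensional ℝ E] {ι : Type*} (g : ι → E)
    (J : Finset ι) :
    ∃ K : ℝ, 0 ≤ K ∧ ∀ e : E, (∀ d : E, (∀ i ∈ J, ⟪g i, d⟫_ℝ ≤ 0) → ⟪e, d⟫_ℝ ≤ 0) →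
      ∀ r : ℝ, 0 ≤ r → (∀ i ∈ J, ⟪g i, e⟫_ℝ ≤ r) → ‖e‖ ≤ K * r := by
  let F : E → ℝ := fun e => ∑ i ∈ J, max ⟪g i, e⟫_ℝ 0
  have hF : Continuous F := by fun_prop
  let P : Set E := {e | ∀ d : E, (∀ i ∈ J, ⟪g i, d⟫_ℝ ≤ 0) → ⟪e, d⟫_ℝ ≤ 0}
  have hP : IsClosed P := by
    simp only [P, Set.ofPred_forall]
    refine isClosed_iInter fun d => isClosed_iInter fun _ => ?_
    exact isClosed_le (by fun_prop) continuous_const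
  have hcomp : IsCompact (Metric.sphere (0 : E) 1 ∩ P) := (isCompact_sphere 0 1).inter_right hP
  -- The total violation `F` is positive on unit vectors of the polar: if it vanished at `e0`, then
  -- `e0` would lie in the cone and in its polar, so `⟪e0, e0⟫ ≤ 0`. Compactness gives a uniform
  -- `δ`, and homogeneity extends the bound to all vectors.
  obtain ⟨δ, hδ, hmin⟩ : ∃ δ : ℝ, 0 < δ ∧ ∀ e ∈ Metric.sphere (0 : E) 1 ∩ P, δ ≤ F e := by
    rcases (Metric.sphere (0 : E) 1 ∩ P).eq_empty_or_nonempty with h | h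
    · exact ⟨1, one_pos, by simp [h]⟩
    · obtain ⟨e0, he0, hmin⟩ := hcomp.exists_isMinOn h hF.continuousOn
      refine ⟨F e0, ?_, fun e he => hmin he⟩
      by_contra hneg
      have hzero : F e0 = 0 := le_antisymm (not_lt.1 hneg)
        (Finset.sum_nonneg fun i _ => le_max_right _ _)
      have hall := (Finset.sum_eq_zero_iff_of_nonneg (fun i _ => le_max_right _ _)).1 hzero
      have h1 := he0.2 e0 (fun i hi => by
        have := hall i hi
        exact (le_max_left _ _).trans this.le)
      have h2 : ‖e0‖ = 1 := by simpa using he0.1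
      rw [real_inner_self_eq_norm_sq, h2] at h1
      norm_num at h1
  refine ⟨J.card / δ, by positivity, fun e he r hr hle => ?_⟩
  rcases eq_or_ne e 0 with rfl | hne
  · simp; positivity
  have hn : 0 < ‖e‖ := norm_pos_iff.2 hne
  have h1 := hmin (‖e‖⁻¹ • e) ⟨by simp [norm_smul, hn.ne'], fun d hd => by
    rw [real_inner_smul_left]
    exact mul_nonpos_of_nonneg_of_nonpos (by positivity) (he d hd)⟩
  have h2 : F (‖e‖⁻¹ • e) ≤ ‖e‖⁻¹ * (J.card * r) := by
    have : ‖e‖⁻¹ * (J.card * r) = ∑ i ∈ J, ‖e‖⁻¹ * r := by simp; ring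
    rw [this]
    refine Finset.sum_le_sum fun i hi => ?_
    rw [inner_smul_right]
    exact max_le (mul_le_mul_of_nonneg_left (hle i hi) (by positivity)) (by positivity)
  have h3 := h1.trans h2
  rw [inv_mul_eq_div, le_div_iff₀ hn] at h3
  rw [div_mul_eq_mul_div, le_div_iff₀ hδ]
  linarith

/-- **Hoffman's lemma**: the distance to a polyhedron is bounded by the violation of its
inequalities, uniformly in the right-hand side. -/
theorem hoffman_bound [FiniteDimensional ℝ E] {ι : Type*} [Finite ι] (g : ι → E) :
    ∃ K : ℝ, 0 ≤ K ∧ ∀ (c : ι → ℝ) (y : E) (r : ℝ), 0 ≤ r → (∃ p, ∀ i, ⟪g i, p⟫_ℝ ≤ c i) →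
      (∀ i, ⟪g i, y⟫_ℝ ≤ c i + r) → ∃ p, (∀ i, ⟪g i, p⟫_ℝ ≤ c i) ∧ ‖y - p‖ ≤ K * r := by
  classical
  have := Fintype.ofFinite ι
  -- The constant depends only on the set of active constraints, of which there are finitely many;
  -- this is why it is uniform in `c`.
  choose K hK0 hK using fun J : Finset ι => exists_norm_le_of_mem_polar g J
  obtain ⟨M, hM⟩ := Finite.exists_le K
  refine ⟨M, (hK0 ∅).trans (hM ∅), fun c y r hr hne hy => ?_⟩
  let P : Set E := {p | ∀ i, ⟪g i, p⟫_ℝ ≤ c i}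
  have hPc : IsClosed P := by
    simp only [P, Set.ofPred_forall]
    exact isClosed_iInter fun i => isClosed_le (by fun_prop) continuous_const
  have hPconv : Convex ℝ P := by
    intro p hp q hq s t hs ht hst i
    rw [inner_add_right, inner_smul_right, inner_smul_right]
    have h1 := mul_le_mul_of_nonneg_left (hp i) hs
    have h2 := mul_le_mul_of_nonneg_left (hq i) ht
    have : s * c i + t * c i = c i := by rw [← add_mul, hst, one_mul]
    linarith
  obtain ⟨p, hp, hmin⟩ := exists_norm_eq_iInf_of_complete_convex (K := P) hne hPc.isComplete hPconv y
  rw [norm_eq_iInf_iff_real_inner_le_zero hPconv hp] at hmin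
  refine ⟨p, hp, ?_⟩
  -- At the projection `p` of `y`, the vector `y - p` is polar to the cone of feasible directions,
  -- which is cut out by the active constraints alone.
  let J : Finset ι := Finset.univ.filter fun i => ⟪g i, p⟫_ℝ = c i
  refine (hK J (y - p) ?_ r hr ?_).trans (mul_le_mul_of_nonneg_right (hM J) hr)
  · intro d hd
    obtain ⟨t, ht, hfeas⟩ := exists_pos_step_feasible hp (d := d)
      (fun i hi => hd i (by simp [J, hi]))
    have := hmin _ hfeas
    rw [add_sub_cancel_left, inner_smul_right] at this
    by_contra hcon
    nlinarith [mul_pos ht (not_le.1 hcon)]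
  · intro i hi
    have hi' : ⟪g i, p⟫_ℝ = c i := by simpa [J] using hi
    rw [inner_sub_right, hi']
    linarith [hy i]

/-- An infeasible system of linear inequalities remains infeasible after a small relaxation. -/
theorem exists_pos_infeasible [FiniteDimensional ℝ E] {ι : Type*} [Finite ι] (g : ι → E)
    (c : ι → ℝ) (hne : ¬ ∃ p, ∀ i, ⟪g i, p⟫_ℝ ≤ c i) :
    ∃ ε : ℝ, 0 < ε ∧ ¬ ∃ p, ∀ i, ⟪g i, p⟫_ℝ ≤ c i + ε := by
  by_contra hcon
  push Not at hcon
  obtain ⟨K, hK0, hK⟩ := hoffman_bound g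
  obtain ⟨r, hr⟩ := Finite.exists_le fun i => - c i
  -- Hoffman's bound at the point `0` puts solutions of all the relaxed systems in one ball, since
  -- its constant ignores the right-hand side. A limit point solves the original system.
  have hseq : ∀ n : ℕ, ∃ p, (∀ i, ⟪g i, p⟫_ℝ ≤ c i + 1 / ((n : ℝ) + 1)) ∧
      p ∈ Metric.closedBall (0 : E) (K * max r 0) := by
    intro n
    have hn : (0 : ℝ) < 1 / ((n : ℝ) + 1) := by positivity
    obtain ⟨p, hp, hp'⟩ := hK (fun i => c i + 1 / ((n : ℝ) + 1)) 0 (max r 0) (le_max_right _ _)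
      (hcon _ hn) (fun i => by
        rw [inner_zero_right]
        linarith [hr i, le_max_left r 0])
    exact ⟨p, hp, by simpa using hp'⟩
  choose p hp hpb using hseq
  obtain ⟨q, -, φ, hφ, hlim⟩ := (isCompact_closedBall (0 : E) (K * max r 0)).tendsto_subseq hpb
  refine hne ⟨q, fun i => ?_⟩
  have h1 : Tendsto (fun n => ⟪g i, p (φ n)⟫_ℝ) atTop (𝓝 ⟪g i, q⟫_ℝ) :=
    tendsto_const_nhds.inner hlim
  have h2 : Tendsto (fun n => c i + 1 / ((φ n : ℝ) + 1)) atTop (𝓝 (c i + 0)) :=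
    (tendsto_one_div_add_atTop_nhds_zero_nat.comp hφ.tendsto_atTop).const_add _
  rw [add_zero] at h2
  exact le_of_tendsto_of_tendsto' h1 h2 fun n => hp (φ n) i

/-- The solution set of finitely many linear inequalities, indexed by any finite type. -/
theorem isPolyhedralSet_setOf {ι : Type*} [Finite ι] (g : ι → E) (β : ι → ℝ) :
    IsPolyhedralSet {x | ∀ i, ⟪g i, x⟫_ℝ ≤ β i} := by
  obtain ⟨m, ⟨e⟩⟩ := Finite.exists_equiv_fin ι
  refine ⟨m, g ∘ e.symm, β ∘ e.symm, ?_⟩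
  ext x
  exact ⟨fun h i => h _, fun h i => by simpa using h (e i)⟩

theorem IsPolyhedralSet.iInter {ι : Type*} [Finite ι] {C : ι → Set E}
    (h : ∀ i, IsPolyhedralSet (C i)) : IsPolyhedralSet (⋂ i, C i) := by
  choose m g β hC using h
  have : (⋂ i, C i) = {x | ∀ k : Σ i, Fin (m i), ⟪g k.1 k.2, x⟫_ℝ ≤ β k.1 k.2} := by
    ext x
    simp only [hC, Set.mem_iInter, Set.mem_ofPred_eq]
    exact ⟨fun h k => h _ _, fun h i k => h ⟨i, k⟩⟩
  rw [this]
  exact isPolyhedralSet_setOf _ _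

theorem IsPolyhedralSet.inter {C C' : Set E} (h : IsPolyhedralSet C) (h' : IsPolyhedralSet C') :
    IsPolyhedralSet (C ∩ C') := by
  rw [Set.inter_eq_iInter]
  exact IsPolyhedralSet.iInter (Bool.forall_bool.2 ⟨h', h⟩)

theorem isPolyhedralSet_halfspace [CompleteSpace E] (l : E →L[ℝ] ℝ) (β : ℝ) :
    IsPolyhedralSet {x | l x ≤ β} := by
  have := isPolyhedralSet_setOf (fun _ : Unit => (InnerProductSpace.toDual ℝ E).symm l)
    (fun _ => β)
  simpa using this

theorem isPolyhedralSet_univ : IsPolyhedralSet (Set.univ : Set E) :=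
  ⟨0, Fin.elim0, Fin.elim0, by simp⟩

theorem IsPolyhedralSet.preimage {F : Type*} [NormedAddCommGroup F] [InnerProductSpace ℝ F]
    [CompleteSpace E] [CompleteSpace F] {C : Set F} (h : IsPolyhedralSet C) (l : E →L[ℝ] F) :
    IsPolyhedralSet (l ⁻¹' C) := by
  obtain ⟨m, g, β, rfl⟩ := h
  have := isPolyhedralSet_setOf (fun i => l.adjoint (g i)) β
  simpa [ContinuousLinearMap.adjoint_inner_left] using this

/-- Affine equations define polyhedral sets. -/
theorem isPolyhedralSet_eq {F : Type*} [NormedAddCommGroup F] [InnerProductSpace ℝ F]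
    [FiniteDimensional ℝ F] [CompleteSpace E] (l : E →L[ℝ] F) (b : F) :
    IsPolyhedralSet {x | l x = b} := by
  let o := stdOrthonormalBasis ℝ F
  have : {x | l x = b} = ⋂ i, ({x | (innerSL ℝ (o i) ∘L l) x ≤ ⟪o i, b⟫_ℝ} ∩
      {x | (- (innerSL ℝ (o i) ∘L l)) x ≤ - ⟪o i, b⟫_ℝ}) := by
    ext x
    simp only [Set.mem_ofPred_eq, Set.mem_iInter, Set.mem_inter_iff]
    constructor
    · rintro rfl i; simp
    · intro h
      refine o.repr.injective (by
        ext i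
        rw [o.repr_apply_apply, o.repr_apply_apply]
        have := h i
        simp at this
        exact le_antisymm this.1 this.2)
  rw [this]
  exact IsPolyhedralSet.iInter fun i =>
    (isPolyhedralSet_halfspace _ _).inter (isPolyhedralSet_halfspace _ _)

variable {Y Z : Type*} [NormedAddCommGroup Y] [InnerProductSpace ℝ Y] [FiniteDimensional ℝ Y]
  [NormedAddCommGroup Z] [InnerProductSpace ℝ Z]

/-- The inverse of a multifunction with polyhedral graph is upper Lipschitz at the origin. -/
theorem IsPolyhedralSet.exists_upper_lipschitz {G : Set (WithLp 2 (Y × Z))}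
    (hG : IsPolyhedralSet G) :
    ∃ a ε : ℝ, 0 ≤ a ∧ 0 < ε ∧ ∀ y v, WithLp.toLp 2 (y, v) ∈ G → ‖v‖ < ε →
      ∃ y0, WithLp.toLp 2 (y0, 0) ∈ G ∧ ‖y - y0‖ ≤ a * ‖v‖ := by
  obtain ⟨m, g, β, rfl⟩ := hG
  obtain ⟨M0, hM0⟩ := Finite.exists_le fun i => ‖(g i).snd‖
  obtain ⟨M, hM, hMpos⟩ : ∃ M : ℝ, (∀ i, ‖(g i).snd‖ ≤ M) ∧ 0 < M :=
    ⟨max M0 1, fun i => (hM0 i).trans (le_max_left _ _), by positivity⟩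
  have hrelax : ∀ y v, (∀ i, ⟪g i, WithLp.toLp 2 (y, v)⟫_ℝ ≤ β i) →
      ∀ i, ⟪(g i).fst, y⟫_ℝ ≤ β i + M * ‖v‖ := by
    intro y v h i
    have h1 := h i
    rw [WithLp.prod_inner_apply] at h1
    have h2 : - ⟪(g i).snd, v⟫_ℝ ≤ M * ‖v‖ :=
      (neg_le_abs _).trans ((abs_real_inner_le_norm _ _).trans
        (mul_le_mul_of_nonneg_right (hM i) (norm_nonneg _)))
    simp only at h1
    change ⟪(g i).fst, y⟫_ℝ + ⟪(g i).snd, v⟫_ℝ ≤ _ at h1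
    linarith
  have hzero : ∀ y, (∀ i, ⟪(g i).fst, y⟫_ℝ ≤ β i) →
      WithLp.toLp 2 (y, (0 : Z)) ∈ {x : WithLp 2 (Y × Z) | ∀ i, ⟪g i, x⟫_ℝ ≤ β i} := by
    intro y h i
    rw [WithLp.prod_inner_apply]
    simpa using h i
  -- The slice of the graph at `v` lies in the slice at `0` relaxed by `M ‖v‖`. If the latter slice
  -- is nonempty, Hoffman's bound applies; otherwise slices at small `v` are empty too.
  by_cases hne : ∃ p, ∀ i, ⟪(g i).fst, p⟫_ℝ ≤ β i
  · obtain ⟨K, hK0, hK⟩ := hoffman_bound fun i => (g i).fst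
    refine ⟨K * M, 1, by positivity, one_pos, fun y v hyv _ => ?_⟩
    obtain ⟨p, hp, hp'⟩ := hK β y (M * ‖v‖) (by positivity) hne (hrelax y v hyv)
    exact ⟨p, hzero p hp, by rwa [mul_assoc]⟩
  · obtain ⟨ε, hε, hinf⟩ := exists_pos_infeasible _ _ hne
    refine ⟨0, ε / M, le_rfl, by positivity, fun y v hyv hv => ?_⟩
    refine absurd ⟨y, fun i => (hrelax y v hyv i).trans ?_⟩ hinf
    rw [lt_div_iff₀ hMpos] at hv
    linarith

/-- The inverse of a polyhedral multifunction is upper Lipschitz at the origin. -/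
theorem exists_upper_lipschitz_of_iUnion {ι : Type*} [Finite ι] {G : ι → Set (WithLp 2 (Y × Z))}
    (hG : ∀ i, IsPolyhedralSet (G i)) :
    ∃ a ε : ℝ, 0 ≤ a ∧ 0 < ε ∧ ∀ y v, WithLp.toLp 2 (y, v) ∈ ⋃ i, G i → ‖v‖ < ε →
      ∃ y0, WithLp.toLp 2 (y0, 0) ∈ ⋃ i, G i ∧ ‖y - y0‖ ≤ a * ‖v‖ := by
  choose a ε ha hε h using fun i => (hG i).exists_upper_lipschitz
  obtain ⟨M, hM⟩ := Finite.exists_le a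
  have : ∀ᶠ δ : ℝ in 𝓝[>] 0, ∀ i, δ < ε i :=
    eventually_all.2 fun i => (eventually_lt_nhds (hε i)).filter_mono nhdsWithin_le_nhds
  obtain ⟨δ, hδ, hδ0⟩ := (this.and self_mem_nhdsWithin).exists
  refine ⟨max M 0, δ, le_max_right _ _, hδ0, fun y v hyv hv => ?_⟩
  obtain ⟨i, hi⟩ := Set.mem_iUnion.1 hyv
  obtain ⟨y0, h1, h2⟩ := h i y v hi (hv.trans (hδ i))
  exact ⟨y0, Set.mem_iUnion.2 ⟨i, h1⟩, h2.trans (mul_le_mul_of_nonneg_right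
    ((hM i).trans (le_max_left _ _)) (norm_nonneg _))⟩

end PolyhedralGeometry

/-! ### Subdifferentials of convex piecewise linear-quadratic functions. -/

section PiecewiseLinearQuadratic

variable {E : Type*} [NormedAddCommGroup E] [InnerProductSpace ℝ E]

theorem mem_subdifferential_coe {g : E → ℝ} {x v : E} :
    v ∈ subdifferential (fun y => ((g y : ℝ) : EReal)) x ↔ ∀ y, g x + ⟪v, y - x⟫_ℝ ≤ g y := by
  simp only [subdifferential, Set.mem_ofPred_eq, ← EReal.coe_add, EReal.coe_le_coe_iff]
  exact ⟨fun h => h.2, fun h => ⟨EReal.coe_ne_top _, h⟩⟩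

theorem IsPolyhedralSet.convex {C : Set E} (h : IsPolyhedralSet C) : Convex ℝ C := by
  obtain ⟨m, g, β, rfl⟩ := h
  intro p hp q hq s t hs ht hst i
  rw [inner_add_right, inner_smul_right, inner_smul_right]
  have h1 := mul_le_mul_of_nonneg_left (hp i) hs
  have h2 := mul_le_mul_of_nonneg_left (hq i) ht
  have : s * β i + t * β i = β i := by rw [← add_mul, hst, one_mul]
  linarith

theorem IsPolyhedralSet.isClosed {C : Set E} (h : IsPolyhedralSet C) : IsClosed C := by
  obtain ⟨m, g, β, rfl⟩ := h
  simp only [Set.ofPred_forall]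
  exact isClosed_iInter fun i => isClosed_le (by fun_prop) continuous_const

theorem ConvexOn.continuous_of_univ [FiniteDimensional ℝ E] {g : E → ℝ}
    (h : ConvexOn ℝ Set.univ g) : Continuous g :=
  continuousOn_univ.1 (h.continuousOn isOpen_univ)

/-- Discards second-order remainders: after division by the step length `t`, such a remainder is `t
* k` and vanishes as `t → 0+`. -/
theorem nonpos_of_forall_le_mul {a k t₀ : ℝ} (ht₀ : 0 < t₀)
    (h : ∀ t, 0 < t → t ≤ t₀ → a ≤ t * k) : a ≤ 0 := by
  have h1 : Tendsto (fun t : ℝ => t * k) (𝓝[>] 0) (𝓝 0) := by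
    have : ContinuousAt (fun t : ℝ => t * k) 0 := by fun_prop
    simpa [ContinuousAt] using this.mono_left (nhdsWithin_le_nhds (s := Set.Ioi 0))
  refine ge_of_tendsto h1 ?_
  filter_upwards [Ioc_mem_nhdsGT ht₀] with t ht using h t ht.1 ht.2

/-- The gradient of the quadratic polynomial `x ↦ ⟪x, Q x⟫ / 2 + ⟪c, x⟫ + r`. -/
noncomputable def quadraticGradient [CompleteSpace E] (Q : E →L[ℝ] E) (c x : E) : E :=
  ((1 / 2 : ℝ) • (Q + Q.adjoint)) x + c

/-- `Q` need not be self-adjoint, so the first-order term involves its symmetric part, while the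
second-order term sees `Q` itself. -/
theorem quadratic_expansion [CompleteSpace E] (Q : E →L[ℝ] E) (c : E) (r : ℝ) (x d : E) (t : ℝ) :
    (1 / 2) * ⟪x + t • d, Q (x + t • d)⟫_ℝ + ⟪c, x + t • d⟫_ℝ + r =
      ((1 / 2) * ⟪x, Q x⟫_ℝ + ⟪c, x⟫_ℝ + r) + t * ⟪quadraticGradient Q c x, d⟫_ℝ
        + t ^ 2 * ((1 / 2) * ⟪d, Q d⟫_ℝ) := by
  have h1 : ⟪Q.adjoint x, d⟫_ℝ = ⟪x, Q d⟫_ℝ := ContinuousLinearMap.adjoint_inner_left _ _ _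
  have h2 : ⟪Q x, d⟫_ℝ = ⟪d, Q x⟫_ℝ := real_inner_comm _ _
  simp only [quadraticGradient, map_add, map_smul, inner_add_left, inner_add_right,
    inner_smul_right, real_inner_smul_left, smul_apply,
    add_apply, h1, h2]
  ring

/-- The subgradients of a convex piecewise quadratic function at `w` are the vectors which differ
from the gradient of each active quadratic piece by a normal vector to its cell. -/
theorem ConvexOn.subgradient_iff_cells [CompleteSpace E] {H : E → ℝ} (hH : ConvexOn ℝ Set.univ H)
    {ι : Type*} [Finite ι] {C : ι → Set E} (hC : ∀ i, IsPolyhedralSet (C i))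
    (hcov : (⋃ i, C i) = Set.univ) {Q : ι → E →L[ℝ] E} {c : ι → E} {r : ι → ℝ}
    (hq : ∀ i, ∀ x ∈ C i, H x = (1 / 2) * ⟪x, Q i x⟫_ℝ + ⟪c i, x⟫_ℝ + r i) (w s : E) :
    (∀ y, H w + ⟪s, y - w⟫_ℝ ≤ H y) ↔
      ∀ i, w ∈ C i → ∀ y ∈ C i, ⟪s - quadraticGradient (Q i) (c i) w, y - w⟫_ℝ ≤ 0 := by
  constructor
  · intro h i hw y hy
    refine nonpos_of_forall_le_mul (k := (1 / 2) * ⟪y - w, Q i (y - w)⟫_ℝ) one_pos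
      fun t ht ht1 => ?_
    have hmem : w + t • (y - w) ∈ C i := (hC i).convex.add_smul_sub_mem hw hy ⟨ht.le, ht1⟩
    have h1 := h (w + t • (y - w))
    rw [hq i _ hmem, quadratic_expansion, ← hq i _ hw, add_sub_cancel_left, inner_smul_right] at h1
    rw [inner_sub_left]
    by_contra hcon
    nlinarith [mul_pos ht (sub_pos.2 (not_le.1 hcon))]
  · intro h y
    -- Finitely many cells cover the segment towards `y`, so one of them contains points of it
    -- arbitrarily near `w`. Being closed and convex, that cell contains `w` and an initial piece of
    -- the segment, where `H` is one quadratic.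
    obtain ⟨i, hi⟩ : ∃ i, ∃ᶠ t : ℝ in 𝓝[>] 0, w + t • (y - w) ∈ C i := by
      by_contra hcon
      simp only [not_exists, not_frequently] at hcon
      obtain ⟨t, ht⟩ := (eventually_all.2 hcon).exists
      have : w + t • (y - w) ∈ ⋃ i, C i := hcov ▸ Set.mem_univ _
      obtain ⟨i, hi⟩ := Set.mem_iUnion.1 this
      exact ht i hi
    have hw : w ∈ C i := by
      refine (hC i).isClosed.mem_of_frequently_of_tendsto hi ?_
      have : ContinuousAt (fun t : ℝ => w + t • (y - w)) 0 := by fun_prop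
      simpa [ContinuousAt] using this.mono_left (nhdsWithin_le_nhds (s := Set.Ioi 0))
    obtain ⟨t₀, ht₀, hpos, hle⟩ :=
      (hi.and_eventually (Ioc_mem_nhdsGT (one_pos : (0 : ℝ) < 1))).exists
    have h0 : ⟪s - quadraticGradient (Q i) (c i) w, y - w⟫_ℝ ≤ 0 := by
      have := h i hw _ ht₀
      rw [add_sub_cancel_left, inner_smul_right] at this
      by_contra hcon
      nlinarith [mul_pos hpos (not_le.1 hcon)]
    rw [inner_sub_left] at h0
    suffices hs : H w + ⟪s, y - w⟫_ℝ - H y ≤ 0 by linarith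
    refine nonpos_of_forall_le_mul (k := - ((1 / 2) * ⟪y - w, Q i (y - w)⟫_ℝ)) hpos
      fun t ht htle => ?_
    have hmem : w + t • (y - w) ∈ C i := by
      have := (hC i).convex.add_smul_sub_mem hw ht₀ (t := t / t₀)
        ⟨by positivity, (div_le_one hpos).2 htle⟩
      rwa [add_sub_cancel_left, smul_smul, div_mul_cancel₀ _ hpos.ne'] at this
    -- Convexity bounds the difference quotient at `w` by `H y - H w`, so the slope of the quadratic
    -- piece transfers the local inequality to `y`.
    have h1 := hH.2 (Set.mem_univ w) (Set.mem_univ y) (sub_nonneg.2 (htle.trans hle)) ht.le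
      (by ring)
    have h2 : (1 - t) • w + t • y = w + t • (y - w) := by module
    rw [h2, hq i _ hmem, quadratic_expansion, ← hq i _ hw, smul_eq_mul, smul_eq_mul] at h1
    by_contra hcon
    nlinarith [mul_pos ht (sub_pos.2 (not_le.1 hcon)), mul_le_mul_of_nonneg_left h0 ht.le]

/-- The vectors normal to a polyhedral set, shifted by an affine map, form a finite union of
polyhedral sets. -/
theorem IsPolyhedralSet.exists_normal_graph [FiniteDimensional ℝ E] {C : Set E}
    (hC : IsPolyhedralSet C) (T : E →L[ℝ] E) (c : E) :
    ∃ (ι : Type) (_ : Finite ι) (P : ι → Set (WithLp 2 (E × E))), (∀ k, IsPolyhedralSet (P k)) ∧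
      ∀ q, q ∈ ⋃ k, P k ↔
        q.fst ∈ C ∧ ∀ y ∈ C, ⟪q.snd - (T q.fst + c), y - q.fst⟫_ℝ ≤ 0 := by
  obtain ⟨m, g, β, rfl⟩ := hC
  classical
  choose R hR hpol using fun J : Finset (Fin m) => exists_finset_polar_generators (J.image g)
  simp only [Finset.forall_mem_image] at hR hpol
  let F : WithLp 2 (E × E) →L[ℝ] E := WithLp.fstL 2 ℝ E E
  let S : WithLp 2 (E × E) →L[ℝ] E := WithLp.sndL 2 ℝ E E
  -- The piece `J` asks that the constraints in `J` be active and that the shifted vector be polar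
  -- to their cone; the generators `R J` make this finitely many linear inequalities. `J` may omit
  -- active constraints, which only shrinks the set of normals; taking all of them gives every
  -- normal.
  refine ⟨Finset (Fin m), inferInstance, fun J =>
    (F ⁻¹' {x | ∀ i, ⟪g i, x⟫_ℝ ≤ β i} ∩
      ⋂ k : J, {q | (- (innerSL ℝ (g k) ∘L F)) q ≤ - β k}) ∩
      ⋂ r : R J, {q | (innerSL ℝ (r : E) ∘L (S - T ∘L F)) q ≤ ⟪(r : E), c⟫_ℝ}, ?_, ?_⟩
  · intro J
    refine (((isPolyhedralSet_setOf g β).preimage F).inter (IsPolyhedralSet.iInter fun k =>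
      isPolyhedralSet_halfspace _ _)).inter (IsPolyhedralSet.iInter fun r =>
      isPolyhedralSet_halfspace _ _)
  · intro q
    have hF : F q = q.fst := rfl
    have hS : S q = q.snd := rfl
    have key : ∀ J, (∀ r ∈ R J, ⟪r, q.snd - T q.fst⟫_ℝ ≤ ⟪r, c⟫_ℝ) ↔
        ∀ d, (∀ k ∈ J, ⟪g k, d⟫_ℝ ≤ 0) → ⟪q.snd - (T q.fst + c), d⟫_ℝ ≤ 0 := by
      intro J
      have hr : ∀ r, ⟪r, q.snd - T q.fst⟫_ℝ ≤ ⟪r, c⟫_ℝ ↔ ⟪q.snd - (T q.fst + c), r⟫_ℝ ≤ 0 := by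
        intro r
        rw [← sub_sub, real_inner_comm r (q.snd - T q.fst - c), inner_sub_right r (q.snd - T q.fst) c,
          sub_nonpos]
      simp only [hr]
      exact ⟨fun h d hd => hpol J _ h d hd, fun h r hrm => h r (hR J r hrm)⟩
    simp only [Set.mem_iUnion, Set.mem_inter_iff, Set.mem_preimage, Set.mem_iInter,
      Set.mem_ofPred_eq, neg_apply, ContinuousLinearMap.comp_apply,
      innerSL_apply_apply, neg_le_neg_iff, sub_apply, hF, hS, Subtype.forall]
    constructor
    · rintro ⟨J, ⟨hmem, hact⟩, hgen⟩
      refine ⟨hmem, fun y hy => (key J).1 hgen _ fun k hk => ?_⟩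
      rw [inner_sub_right]
      linarith [hy k, hact k hk]
    · rintro ⟨hmem, hn⟩
      refine ⟨Finset.univ.filter fun k => ⟪g k, q.fst⟫_ℝ = β k, ⟨hmem, fun k hk => ?_⟩,
        (key _).2 fun d hd => ?_⟩
      · exact (Finset.mem_filter.1 hk).2.ge
      · obtain ⟨t, ht, hfeas⟩ := exists_pos_step_feasible hmem (d := d)
          (fun i hi => hd i (by simp [hi]))
        have := hn _ hfeas
        rw [add_sub_cancel_left, inner_smul_right] at this
        by_contra hcon
        nlinarith [mul_pos ht (not_le.1 hcon)]

/-- The graph of the subdifferential of a convex piecewise linear-quadratic function is a finite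
union of polyhedral sets. -/
theorem ConvexOn.exists_polyhedral_subdifferential_graph [FiniteDimensional ℝ E] {H : E → ℝ}
    (hH : ConvexOn ℝ Set.univ H) (hplq : IsPiecewiseLinearQuadratic H) :
    ∃ (ι : Type) (_ : Finite ι) (S : ι → Set (WithLp 2 (E × E))), (∀ k, IsPolyhedralSet (S k)) ∧
      ∀ q, q ∈ ⋃ k, S k ↔ ∀ y, H q.fst + ⟪q.snd, y - q.fst⟫_ℝ ≤ H y := by
  obtain ⟨m, C, hC, hcov, hq⟩ := hplq
  choose Q c r hq using hq
  have hsub := hH.subgradient_iff_cells hC hcov hq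
  choose ι hι P hP hPmem using fun i =>
    (hC i).exists_normal_graph ((1 / 2 : ℝ) • (Q i + (Q i).adjoint)) (c i)
  choose N g β hCg using hC
  -- For each cell, either the normality condition holds in some polyhedral piece, or the point
  -- violates some inequality of the cell. The choice `τ` records which. The sets `strict τ` cover
  -- the graph but are not closed; `weak τ` relaxes the strict inequalities.
  let strict : (∀ i, ι i ⊕ Fin (N i)) → Set (WithLp 2 (E × E)) := fun τ =>
    ⋂ i, Sum.elim (P i) (fun k => {q | β i k < ⟪g i k, q.fst⟫_ℝ}) (τ i)
  let weak : (∀ i, ι i ⊕ Fin (N i)) → Set (WithLp 2 (E × E)) := fun τ =>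
    ⋂ i, Sum.elim (P i) (fun k =>
      {q | (- (innerSL ℝ (g i k) ∘L WithLp.fstL 2 ℝ E E)) q ≤ - β i k}) (τ i)
  have hweak : ∀ τ q, q ∈ weak τ ↔ ∀ i, (∀ J, τ i = .inl J → q ∈ P i J) ∧
      (∀ k, τ i = .inr k → β i k ≤ ⟪g i k, q.fst⟫_ℝ) := by
    intro τ q
    simp only [weak, Set.mem_iInter]
    refine forall_congr' fun i => ?_
    rcases τ i with J | k <;> simp
  have hstrict : ∀ τ q, q ∈ strict τ ↔ ∀ i, (∀ J, τ i = .inl J → q ∈ P i J) ∧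
      (∀ k, τ i = .inr k → β i k < ⟪g i k, q.fst⟫_ℝ) := by
    intro τ q
    simp only [strict, Set.mem_iInter]
    refine forall_congr' fun i => ?_
    rcases τ i with J | k <;> simp
  have hstrict_sub : ∀ τ q, q ∈ strict τ → ∀ y, H q.fst + ⟪q.snd, y - q.fst⟫_ℝ ≤ H y := by
    intro τ q hmem
    refine (hsub _ _).2 fun i hi => ?_
    rw [hstrict] at hmem
    obtain ⟨h1, h2⟩ := hmem i
    rcases hτ : τ i with J | k
    · exact ((hPmem i q).1 (Set.mem_iUnion.2 ⟨J, h1 J hτ⟩)).2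
    · rw [hCg i] at hi
      exact absurd (hi k) (not_le.2 (h2 k hτ))
  have hcont := hH.continuous_of_univ
  have hclosed : IsClosed {q : WithLp 2 (E × E) |
      ∀ y, H q.fst + ⟪q.snd, y - q.fst⟫_ℝ ≤ H y} := by
    have h1 : Continuous (fun q : WithLp 2 (E × E) => q.fst) := (WithLp.fstL 2 ℝ E E).continuous
    have h2 : Continuous (fun q : WithLp 2 (E × E) => q.snd) := (WithLp.sndL 2 ℝ E E).continuous
    simp only [Set.ofPred_forall]
    refine isClosed_iInter fun y => isClosed_le ?_ continuous_const
    fun_prop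
  -- Moving from a point of `weak τ` towards a point of `strict τ` enters `strict τ` at once, so a
  -- nonempty `strict τ` is dense in `weak τ`.
  have hcomb : ∀ τ q p, q ∈ weak τ → p ∈ strict τ → ∀ t : ℝ, 0 < t → t ≤ 1 →
      q + t • (p - q) ∈ strict τ := by
    intro τ q p hmq hmp t ht ht1
    rw [hstrict] at hmp ⊢
    rw [hweak] at hmq
    refine fun i => ⟨fun J hJ => ?_, fun k hk => ?_⟩
    · exact (hP i J).convex.add_smul_sub_mem ((hmq i).1 J hJ) ((hmp i).1 J hJ) ⟨ht.le, ht1⟩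
    · have h1 := (hmq i).2 k hk
      have h2 := (hmp i).2 k hk
      change β i k < ⟪g i k, q.fst + t • (p.fst - q.fst)⟫_ℝ
      rw [inner_add_right, inner_smul_right, inner_sub_right]
      nlinarith [mul_pos ht (sub_pos.2 h2), mul_nonneg (sub_nonneg.2 ht1) (sub_nonneg.2 h1)]
  -- Only choices with `strict τ` nonempty are kept: for these, density and the closedness of the
  -- graph put `weak τ` inside the graph. For the others `weak τ` might contain foreign points.
  refine ⟨{τ // (strict τ).Nonempty}, inferInstance, fun τ => weak τ.1, fun τ => ?_,
    fun q => ⟨fun hmem => ?_, fun hmem => ?_⟩⟩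
  · refine IsPolyhedralSet.iInter fun i => ?_
    rcases τ.1 i with J | k
    · exact hP i J
    · exact isPolyhedralSet_halfspace _ _
  · obtain ⟨⟨τ, p, hp⟩, hqw⟩ := Set.mem_iUnion.1 hmem
    have hlim : Tendsto (fun t : ℝ => q + t • (p - q)) (𝓝[>] 0) (𝓝 q) := by
      have : ContinuousAt (fun t : ℝ => q + t • (p - q)) 0 := by fun_prop
      simpa [ContinuousAt] using this.mono_left (nhdsWithin_le_nhds (s := Set.Ioi 0))
    refine hclosed.mem_of_tendsto hlim ?_
    filter_upwards [Ioc_mem_nhdsGT (one_pos : (0 : ℝ) < 1)] with t ht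
    exact hstrict_sub τ _ (hcomb τ q p hqw hp t ht.1 ht.2)
  · have hτ : ∀ i, ∃ a : ι i ⊕ Fin (N i), (∀ J, a = .inl J → q ∈ P i J) ∧
        (∀ k, a = .inr k → β i k < ⟪g i k, q.fst⟫_ℝ) := by
      intro i
      by_cases hi : q.fst ∈ C i
      · obtain ⟨J, hJ⟩ := Set.mem_iUnion.1 ((hPmem i q).2 ⟨hi, (hsub _ _).1 hmem i hi⟩)
        exact ⟨.inl J, by rintro _ ⟨⟩; exact hJ, by simp⟩
      · rw [hCg i] at hi
        obtain ⟨k, hk⟩ : ∃ k, β i k < ⟪g i k, q.fst⟫_ℝ := by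
          simpa only [Set.mem_ofPred_eq, not_forall, not_le] using hi
        exact ⟨.inr k, by simp, by rintro _ ⟨⟩; exact hk⟩
    choose τ hτ using hτ
    have hs : q ∈ strict τ := (hstrict τ q).2 hτ
    exact Set.mem_iUnion.2 ⟨⟨τ, q, hs⟩,
      (hweak τ q).2 fun i => ⟨(hτ i).1, fun k hk => ((hτ i).2 k hk).le⟩⟩

/-! ### Calculus of piecewise linear-quadratic functions -/

theorem isPiecewiseLinearQuadratic_of_cells {ι : Type*} [Finite ι] {f : E → ℝ} (C : ι → Set E)
    (hC : ∀ i, IsPolyhedralSet (C i)) (hcov : ∀ x, ∃ i, x ∈ C i)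
    (hq : ∀ i, ∃ (Q : E →L[ℝ] E) (c : E) (r : ℝ),
      ∀ x ∈ C i, f x = (1 / 2) * ⟪x, Q x⟫_ℝ + ⟪c, x⟫_ℝ + r) :
    IsPiecewiseLinearQuadratic f := by
  obtain ⟨m, ⟨e⟩⟩ := Finite.exists_equiv_fin ι
  refine ⟨m, C ∘ e.symm, fun i => hC _, Set.eq_univ_of_forall fun x => ?_, fun i => hq _⟩
  obtain ⟨i, hi⟩ := hcov x
  exact Set.mem_iUnion.2 ⟨e i, by simpa using hi⟩

theorem IsPiecewiseLinearQuadratic.add {f g : E → ℝ} (hf : IsPiecewiseLinearQuadratic f)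
    (hg : IsPiecewiseLinearQuadratic g) : IsPiecewiseLinearQuadratic (fun x => f x + g x) := by
  obtain ⟨m, C, hC, hcov, hq⟩ := hf
  obtain ⟨m', C', hC', hcov', hq'⟩ := hg
  refine isPiecewiseLinearQuadratic_of_cells (fun k : Fin m × Fin m' => C k.1 ∩ C' k.2)
    (fun k => (hC k.1).inter (hC' k.2)) (fun x => ?_) (fun k => ?_)
  · obtain ⟨i, hi⟩ := Set.mem_iUnion.1 (hcov ▸ Set.mem_univ x)
    obtain ⟨i', hi'⟩ := Set.mem_iUnion.1 (hcov' ▸ Set.mem_univ x)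
    exact ⟨(i, i'), hi, hi'⟩
  · obtain ⟨Q, c, r, h⟩ := hq k.1
    obtain ⟨Q', c', r', h'⟩ := hq' k.2
    refine ⟨Q + Q', c + c', r + r', fun x hx => ?_⟩
    rw [h x hx.1, h' x hx.2, add_apply, inner_add_right, inner_add_left]
    ring

theorem isPiecewiseLinearQuadratic_const (r : ℝ) :
    IsPiecewiseLinearQuadratic (fun _ : E => r) :=
  isPiecewiseLinearQuadratic_of_cells (fun _ : Unit => Set.univ) (fun _ => isPolyhedralSet_univ)
    (fun _ => ⟨(), trivial⟩) (fun _ => ⟨0, 0, r, by simp⟩)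

theorem IsPiecewiseLinearQuadratic.sum {ι : Type*} (s : Finset ι) {f : ι → E → ℝ}
    (hf : ∀ i, IsPiecewiseLinearQuadratic (f i)) :
    IsPiecewiseLinearQuadratic (fun x => ∑ i ∈ s, f i x) := by
  classical
  induction s using Finset.induction_on with
  | empty => simpa using isPiecewiseLinearQuadratic_const 0
  | insert i s hi ih => simpa [Finset.sum_insert hi] using (hf i).add ih

theorem IsPiecewiseLinearQuadratic.const_mul {f : E → ℝ} (hf : IsPiecewiseLinearQuadratic f)
    (a : ℝ) : IsPiecewiseLinearQuadratic (fun x => a * f x) := by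
  obtain ⟨m, C, hC, hcov, hq⟩ := hf
  refine ⟨m, C, hC, hcov, fun i => ?_⟩
  obtain ⟨Q, c, r, h⟩ := hq i
  refine ⟨a • Q, a • c, a * r, fun x hx => ?_⟩
  simp only [h x hx]
  rw [smul_apply, inner_smul_right, real_inner_smul_left]
  ring

theorem IsPiecewiseLinearQuadratic.comp {F : Type*} [NormedAddCommGroup F]
    [InnerProductSpace ℝ F] [CompleteSpace E] [CompleteSpace F] {f : F → ℝ}
    (hf : IsPiecewiseLinearQuadratic f) (l : E →L[ℝ] F) :
    IsPiecewiseLinearQuadratic (fun x => f (l x)) := by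
  obtain ⟨m, C, hC, hcov, hq⟩ := hf
  refine isPiecewiseLinearQuadratic_of_cells (fun i => l ⁻¹' C i) (fun i => (hC i).preimage l)
    (fun x => by
      simpa using Set.mem_iUnion.1 (hcov ▸ Set.mem_univ (l x) : l x ∈ ⋃ i, C i)) (fun i => ?_)
  obtain ⟨Q, c, r, h⟩ := hq i
  refine ⟨l.adjoint ∘L Q ∘L l, l.adjoint c, r, fun x hx => ?_⟩
  rw [h _ hx, ContinuousLinearMap.comp_apply, ContinuousLinearMap.comp_apply,
    ContinuousLinearMap.adjoint_inner_right, ContinuousLinearMap.adjoint_inner_left]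

theorem isPiecewiseLinearQuadratic_abs [CompleteSpace E] (l : E →L[ℝ] ℝ) :
    IsPiecewiseLinearQuadratic (fun x => |l x|) := by
  have hl : ∀ x, ⟪(InnerProductSpace.toDual ℝ E).symm l, x⟫_ℝ = l x := by simp
  refine isPiecewiseLinearQuadratic_of_cells
    (fun i : Bool => if i then {x | l x ≤ 0} else {x | (-l) x ≤ 0}) (fun i => ?_) (fun x => ?_)
    (fun i => ?_)
  · cases i
    · simpa using isPolyhedralSet_halfspace (-l) 0
    · simpa using isPolyhedralSet_halfspace l 0
  · rcases le_total (l x) 0 with h | h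
    · exact ⟨true, by simpa using h⟩
    · exact ⟨false, by simpa using h⟩
  · cases i
    · exact ⟨0, (InnerProductSpace.toDual ℝ E).symm l, 0, fun x hx => by
        have : 0 ≤ l x := by simpa using hx
        simp [abs_of_nonneg this]⟩
    · exact ⟨0, -(InnerProductSpace.toDual ℝ E).symm l, 0, fun x hx => by
        have : l x ≤ 0 := by simpa using hx
        simp [abs_of_nonpos this]⟩

theorem isPiecewiseLinearQuadratic_norm_sub_sq (x₀ : E) :
    IsPiecewiseLinearQuadratic (fun x => ‖x - x₀‖ ^ 2) := by
  refine isPiecewiseLinearQuadratic_of_cells (fun _ : Unit => Set.univ)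
    (fun _ => isPolyhedralSet_univ) (fun _ => ⟨(), trivial⟩)
    (fun _ => ⟨(2 : ℝ) • ContinuousLinearMap.id ℝ E, (-2 : ℝ) • x₀, ‖x₀‖ ^ 2, fun x _ => ?_⟩)
  rw [norm_sub_sq_real, smul_apply, inner_smul_right, real_inner_smul_left,
    ContinuousLinearMap.id_apply, real_inner_self_eq_norm_sq, real_inner_comm x x₀]
  ring

end PiecewiseLinearQuadratic

/-! ### From upper Lipschitz inverses to error bounds, and back to real distances. -/

section ErrorBounds

variable {E : Type*} [NormedAddCommGroup E]

/-- A multifunction whose inverse is upper Lipschitz at the origin satisfies the error bound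
condition there. -/
theorem hasErrorBoundAtOrigin_of_upper_lipschitz {T : E → Set E} {a ε : ℝ} (ha : 0 ≤ a)
    (hε : 0 < ε) (h : ∀ x v, v ∈ T x → ‖v‖ < ε → ∃ y, 0 ∈ T y ∧ ‖x - y‖ ≤ a * ‖v‖) :
    HasErrorBoundAtOrigin T (a + 1) := by
  refine ⟨by positivity, ε, hε, fun x hx => ?_⟩
  have hsmall : ∀ v ∈ T x, ‖v‖ < ε →
      Metric.infEDist x {q | (0 : E) ∈ T q} ≤ ENNReal.ofReal (a + 1) * edist 0 v := by
    intro v hv hvε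
    obtain ⟨y, hy, hle⟩ := h x v hv hvε
    refine (Metric.infEDist_le_edist_of_mem (show y ∈ {q | (0 : E) ∈ T q} from hy)).trans ?_
    rw [edist_dist, edist_dist, dist_eq_norm, dist_zero_left, ← ENNReal.ofReal_mul (by positivity)]
    exact ENNReal.ofReal_le_ofReal (hle.trans (by nlinarith [norm_nonneg v]))
  obtain ⟨v₀, hv₀, hlt⟩ := Metric.infEDist_lt_iff.1 hx
  rw [edist_dist, dist_zero_left, ENNReal.ofReal_lt_ofReal_iff hε] at hlt
  -- The infimum runs over all of `T x`, including large `v`; these are dominated by the small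
  -- element `v₀`.
  have hall : ∀ v ∈ T x,
      Metric.infEDist x {q | (0 : E) ∈ T q} ≤ ENNReal.ofReal (a + 1) * edist 0 v := by
    intro v hv
    by_cases hvε : ‖v‖ < ε
    · exact hsmall v hv hvε
    · refine (hsmall v₀ hv₀ hlt).trans (mul_le_mul_right ?_ _)
      rw [edist_dist, edist_dist, dist_zero_left, dist_zero_left]
      exact ENNReal.ofReal_le_ofReal (hlt.le.trans (not_lt.1 hvε))
  -- The modulus `a + 1` instead of `a` keeps the factor nonzero, as needed to move it inside the
  -- infimum.
  have h0 : ENNReal.ofReal (a + 1) ≠ 0 := by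
    rw [Ne, ENNReal.ofReal_eq_zero, not_le]; positivity
  rw [Metric.infEDist, Metric.infEDist]
  simp only [ENNReal.mul_iInf_of_ne h0 ENNReal.ofReal_ne_top]
  exact le_iInf₂ hall

/-- The error bound condition in terms of real distances. -/
theorem HasErrorBoundAtOrigin.exists_infDist_le {T : E → Set E} {a : ℝ}
    (h : HasErrorBoundAtOrigin T a) :
    ∃ ε : ℝ, 0 < ε ∧ ∀ x v, v ∈ T x → ‖v‖ < ε →
      Metric.infDist x {q | (0 : E) ∈ T q} ≤ a * ‖v‖ := by
  obtain ⟨ha, ε, hε, h⟩ := h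
  refine ⟨ε, hε, fun x v hv hvε => ?_⟩
  have h1 : Metric.infEDist 0 (T x) ≤ ENNReal.ofReal ‖v‖ := by
    refine (Metric.infEDist_le_edist_of_mem hv).trans ?_
    rw [edist_dist, dist_zero_left]
  have h2 := h x (h1.trans_lt ((ENNReal.ofReal_lt_ofReal_iff hε).2 hvε))
  have h3 : Metric.infEDist x {q | (0 : E) ∈ T q} ≤ ENNReal.ofReal (a * ‖v‖) := by
    rw [ENNReal.ofReal_mul ha]
    exact h2.trans (mul_le_mul_right h1 _)
  exact ENNReal.toReal_le_of_le_ofReal (by positivity) h3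

end ErrorBounds

/-! ### Lagrangian duality for a convex objective under a linear equation. -/

section Duality

variable {E V : Type*} [NormedAddCommGroup E] [InnerProductSpace ℝ E]
  [NormedAddCommGroup V] [InnerProductSpace ℝ V]

/-- The Lagrangian function of the problem of minimizing `H w` subject to `B w = b`. -/
def linLagrangian (H : E → ℝ) (B : E →L[ℝ] V) (b : V) (w : E) (α : V) : ℝ :=
  H w - ⟪B w - b, α⟫_ℝ

/-- The augmented Lagrangian function of the problem of minimizing `H w` subject to `B w = b`. -/
noncomputable def augLinLagrangian (H : E → ℝ) (B : E →L[ℝ] V) (b : V) (ρ : ℝ) (w : E) (α : V) :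
    ℝ :=
  linLagrangian H B b w α + ρ / 2 * ‖B w - b‖ ^ 2

/-- The negative of the dual function of the problem of minimizing `H w` subject to `B w = b`. -/
noncomputable def negDual (H : E → ℝ) (B : E →L[ℝ] V) (b : V) (α : V) : EReal :=
  ⨆ w, ((- linLagrangian H B b w α : ℝ) : EReal)

/-- The subdifferential of the convex-concave Lagrangian, with the sign of the second component
changed. -/
def saddleMap (H : E → ℝ) (B : E →L[ℝ] V) (b : V) (q : WithLp 2 (E × V)) :
    Set (WithLp 2 (E × V)) :=
  {q' | q'.fst ∈ subdifferential (fun w => ((linLagrangian H B b w q.snd : ℝ) : EReal)) q.fst ∧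
    q'.snd ∈ subdifferential (fun α => ((- linLagrangian H B b q.fst α : ℝ) : EReal)) q.snd}

variable {H : E → ℝ} {B : E →L[ℝ] V} {b : V}

/-- The Lagrangian is affine in the multiplier, so its only subgradient there is the constraint
residual; testing with a shift by the difference of the two vectors shows this. -/
theorem mem_saddleMap_iff {q q' : WithLp 2 (E × V)} :
    q' ∈ saddleMap H B b q ↔
      (∀ y, linLagrangian H B b q.fst q.snd + ⟪q'.fst, y - q.fst⟫_ℝ ≤
        linLagrangian H B b y q.snd) ∧ B q.fst - b = q'.snd := by
  simp only [saddleMap, Set.mem_ofPred_eq, mem_subdifferential_coe]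
  refine and_congr_right fun _ => ⟨fun h => ?_, fun h β => ?_⟩
  · have h1 := h (q.snd + (q'.snd - (B q.fst - b)))
    simp only [linLagrangian, inner_add_right, add_sub_cancel_left] at h1
    have h2 : ⟪q'.snd - (B q.fst - b), q'.snd - (B q.fst - b)⟫_ℝ ≤ 0 := by
      rw [inner_sub_left]; linarith
    exact (sub_eq_zero.1 (real_inner_self_nonpos.1 h2)).symm
  · rw [← h, inner_sub_right]
    simp only [linLagrangian]
    linarith

theorem zero_mem_saddleMap_iff {q : WithLp 2 (E × V)} :
    0 ∈ saddleMap H B b q ↔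
      (∀ y, linLagrangian H B b q.fst q.snd ≤ linLagrangian H B b y q.snd) ∧ B q.fst = b := by
  rw [mem_saddleMap_iff]
  simp [sub_eq_zero]

/-- For a convex piecewise linear-quadratic objective, the inverse of the subdifferential of the
Lagrangian is upper Lipschitz at the origin. -/
theorem exists_upper_lipschitz_saddleMap [FiniteDimensional ℝ E] [FiniteDimensional ℝ V]
    (hH : ConvexOn ℝ Set.univ H) (hplq : IsPiecewiseLinearQuadratic H) :
    ∃ a ε : ℝ, 0 ≤ a ∧ 0 < ε ∧ ∀ q v, v ∈ saddleMap H B b q → ‖v‖ < ε →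
      ∃ q₀, 0 ∈ saddleMap H B b q₀ ∧ ‖q - q₀‖ ≤ a * ‖v‖ := by
  obtain ⟨ι, hι, S, hS, hmem⟩ := hH.exists_polyhedral_subdifferential_graph hplq
  let Y := WithLp 2 (E × V)
  let q₁ : WithLp 2 (Y × Y) →L[ℝ] E := WithLp.fstL 2 ℝ E V ∘L WithLp.fstL 2 ℝ Y Y
  let q₂ : WithLp 2 (Y × Y) →L[ℝ] V := WithLp.sndL 2 ℝ E V ∘L WithLp.fstL 2 ℝ Y Y
  let v₁ : WithLp 2 (Y × Y) →L[ℝ] E := WithLp.fstL 2 ℝ E V ∘L WithLp.sndL 2 ℝ Y Y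
  let v₂ : WithLp 2 (Y × Y) →L[ℝ] V := WithLp.sndL 2 ℝ E V ∘L WithLp.sndL 2 ℝ Y Y
  let M : WithLp 2 (Y × Y) →L[ℝ] WithLp 2 (E × E) :=
    (WithLp.prodContinuousLinearEquiv 2 ℝ E E).symm.toContinuousLinearMap ∘L
      (q₁.prod (v₁ + B.adjoint ∘L q₂))
  -- The residual `v` belongs to the saddle map at `(w, α)` exactly when `v₁ + B* α` is a
  -- subgradient of `H` at `w` and `B w - v₂ = b`. Both conditions are pullbacks by linear maps.
  let G : ι → Set (WithLp 2 (Y × Y)) := fun k => M ⁻¹' S k ∩ {r | (B ∘L q₁ - v₂) r = b}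
  obtain ⟨a, ε, ha, hε, h⟩ := exists_upper_lipschitz_of_iUnion (G := G)
    fun k => ((hS k).preimage M).inter (isPolyhedralSet_eq _ _)
  have hG : ∀ q v : Y, WithLp.toLp 2 (q, v) ∈ ⋃ k, G k ↔ v ∈ saddleMap H B b q := by
    intro q v
    have hM : M (WithLp.toLp 2 (q, v)) = WithLp.toLp 2 (q.fst, v.fst + B.adjoint q.snd) := rfl
    have h2 : (B ∘L q₁ - v₂) (WithLp.toLp 2 (q, v)) = B q.fst - v.snd := rfl
    have h1 := hmem (M (WithLp.toLp 2 (q, v)))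
    simp only [Set.mem_iUnion, G, Set.mem_inter_iff, Set.mem_preimage, Set.mem_ofPred_eq,
      exists_and_right, h2] at h1 ⊢
    rw [h1, hM, mem_saddleMap_iff]
    change (∀ y, H q.fst + ⟪v.fst + B.adjoint q.snd, y - q.fst⟫_ℝ ≤ H y) ∧ _ ↔ _
    refine and_congr (forall_congr' fun y => ?_) ?_
    · simp only [linLagrangian, inner_add_left, ContinuousLinearMap.adjoint_inner_left,
        inner_sub_right, inner_sub_left]
      rw [real_inner_comm q.snd (B y), real_inner_comm q.snd (B q.fst)]
      constructor <;> intro h <;> linarith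
    · rw [sub_eq_iff_eq_add, sub_eq_iff_eq_add, add_comm]
  refine ⟨a, ε, ha, hε, fun q v hv hvε => ?_⟩
  obtain ⟨q₀, h1, h2⟩ := h q v ((hG q v).2 hv) hvε
  exact ⟨q₀, (hG q₀ 0).1 h1, h2⟩

/-- A minimizer of the augmented Lagrangian minimizes the Lagrangian for the updated
multiplier. -/
theorem linLagrangian_le_of_isMin_aug (hH : ConvexOn ℝ Set.univ H) {ρ : ℝ} {w : E} {α : V}
    (hmin : ∀ y, augLinLagrangian H B b ρ w α ≤ augLinLagrangian H B b ρ y α) (y : E) :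
    linLagrangian H B b w (α - ρ • (B w - b)) ≤ linLagrangian H B b y (α - ρ • (B w - b)) := by
  rw [← sub_nonpos]
  -- Along the segment from `w` to `y`, the penalty contributes the linear term that shifts the
  -- multiplier, and a remainder `t² k`.
  refine nonpos_of_forall_le_mul (k := ρ / 2 * ‖B (y - w)‖ ^ 2) one_pos fun t ht ht1 => ?_
  have h1 := hmin (w + t • (y - w))
  have h2 := hH.2 (Set.mem_univ w) (Set.mem_univ y) (sub_nonneg.2 ht1) ht.le (by ring)
  have h3 : (1 - t) • w + t • y = w + t • (y - w) := by module
  rw [h3, smul_eq_mul, smul_eq_mul] at h2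
  have h4 : B (w + t • (y - w)) - b = (B w - b) + t • B (y - w) := by
    rw [map_add, map_smul]; abel
  have h5 : B y - b = (B w - b) + B (y - w) := by rw [map_sub]; abel
  simp only [augLinLagrangian, linLagrangian, h4, h5] at h1 ⊢
  generalize B w - b = c at h1 ⊢
  generalize B (y - w) = d at h1 ⊢
  rw [norm_add_sq_real] at h1
  simp only [inner_add_left, inner_sub_right, inner_smul_right, real_inner_smul_left, norm_smul,
    Real.norm_eq_abs, mul_pow, sq_abs, real_inner_comm c d] at h1 ⊢
  by_contra hcon
  nlinarith [mul_pos ht (sub_pos.2 (not_le.1 hcon))]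

theorem neg_linLagrangian_le_negDual (w : E) (α : V) :
    ((- linLagrangian H B b w α : ℝ) : EReal) ≤ negDual H B b α :=
  le_iSup (fun w => ((- linLagrangian H B b w α : ℝ) : EReal)) w

theorem negDual_eq_of_isMin {w : E} {α : V}
    (hmin : ∀ y, linLagrangian H B b w α ≤ linLagrangian H B b y α) :
    negDual H B b α = ((- linLagrangian H B b w α : ℝ) : EReal) :=
  le_antisymm (iSup_le fun y => EReal.coe_le_coe_iff.2 (neg_le_neg (hmin y)))
    (neg_linLagrangian_le_negDual w α)

/-- The negative dual is a supremum of functions affine in `α` with slope `B w - b`; a minimizer of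
the Lagrangian selects one active at `α`. -/
theorem mem_subdifferential_negDual_of_isMin {w : E} {α : V}
    (hmin : ∀ y, linLagrangian H B b w α ≤ linLagrangian H B b y α) :
    B w - b ∈ subdifferential (negDual H B b) α := by
  refine ⟨by rw [negDual_eq_of_isMin hmin]; exact EReal.coe_ne_top _, fun β => ?_⟩
  rw [negDual_eq_of_isMin hmin, ← EReal.coe_add]
  refine le_trans (EReal.coe_le_coe_iff.2 (le_of_eq ?_)) (neg_linLagrangian_le_negDual w β)
  simp only [linLagrangian, inner_sub_right]
  ring

/-- The two subgradient inequalities can be added because both values are real: the supremum is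
never `⊥`, and a subgradient excludes `⊤`. -/
theorem subdifferential_negDual_monotone {α β v v' : V}
    (hv : v ∈ subdifferential (negDual H B b) α) (hv' : v' ∈ subdifferential (negDual H B b) β) :
    0 ≤ ⟪v - v', α - β⟫_ℝ := by
  have hreal : ∀ γ, negDual H B b γ ≠ ⊤ → ∃ r : ℝ, negDual H B b γ = r := fun γ hγ => by
    refine ⟨(negDual H B b γ).toReal, (EReal.coe_toReal hγ ?_).symm⟩
    exact ne_bot_of_le_ne_bot (EReal.coe_ne_bot _) (neg_linLagrangian_le_negDual 0 γ)
  obtain ⟨r, hr⟩ := hreal α hv.1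
  obtain ⟨s, hs⟩ := hreal β hv'.1
  have h1 := hv.2 β
  have h2 := hv'.2 α
  rw [hr, hs, ← EReal.coe_add, EReal.coe_le_coe_iff] at h1 h2
  rw [inner_sub_left]
  have h3 : ⟪v, β - α⟫_ℝ = - ⟪v, α - β⟫_ℝ := by rw [← inner_neg_right, neg_sub]
  linarith

/-- Subgradients of the negative dual function are the constraint residuals of the minimizers of
the Lagrangian. -/
theorem mem_subdifferential_negDual_iff (hH : ConvexOn ℝ Set.univ H)
    (hattain : ∀ ρ : ℝ, 0 < ρ → ∀ α, ∃ w, ∀ y,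
      augLinLagrangian H B b ρ w α ≤ augLinLagrangian H B b ρ y α) {α v : V} :
    v ∈ subdifferential (negDual H B b) α ↔
      ∃ w, (∀ y, linLagrangian H B b w α ≤ linLagrangian H B b y α) ∧ B w - b = v := by
  constructor
  · intro hv
    -- A unit proximal step from `α + v` should return to `α` with residual `v`. Monotonicity
    -- between `v` at `α` and the residual at the new multiplier forces the two residuals to
    -- coincide.
    obtain ⟨w, hw⟩ := hattain 1 one_pos (α + v)
    have hmin := linLagrangian_le_of_isMin_aug hH hw
    have hmono := subdifferential_negDual_monotone hv (mem_subdifferential_negDual_of_isMin hmin)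
    have h1 : α - (α + v - (1 : ℝ) • (B w - b)) = - (v - (B w - b)) := by
      rw [one_smul]; abel
    rw [h1, inner_neg_right, real_inner_self_eq_norm_sq] at hmono
    have h2 : v - (B w - b) = 0 := by
      rw [← norm_eq_zero]
      exact pow_eq_zero_iff two_ne_zero |>.1 (le_antisymm (by linarith) (sq_nonneg _))
    have h3 : α + v - (1 : ℝ) • (B w - b) = α := by
      rw [← sub_eq_zero, ← h2, one_smul]; abel
    rw [h3] at hmin
    exact ⟨w, hmin, (sub_eq_zero.1 h2).symm⟩
  · rintro ⟨w, hw, rfl⟩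
    exact mem_subdifferential_negDual_of_isMin hw

/-- The distance between the updated multiplier and the exact proximal point of the dual is
controlled by the suboptimality in the augmented Lagrangian. -/
theorem norm_sub_sq_le_of_isMin_aug (hH : ConvexOn ℝ Set.univ H) {ρ : ℝ} (hρ : 0 < ρ) {w₀ : E}
    {α : V} (hmin : ∀ y, augLinLagrangian H B b ρ w₀ α ≤ augLinLagrangian H B b ρ y α) (w : E) :
    ‖(α - ρ • (B w - b)) - (α - ρ • (B w₀ - b))‖ ^ 2 ≤
      2 * ρ * (augLinLagrangian H B b ρ w α - augLinLagrangian H B b ρ w₀ α) := by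
  -- The gap in the augmented Lagrangian is the gap in the Lagrangian at the exact updated
  -- multiplier, nonnegative by this line, plus `ρ / 2 * ‖B w - B w₀‖ ^ 2`.
  have h1 := linLagrangian_le_of_isMin_aug hH hmin w
  have h2 : (α - ρ • (B w - b)) - (α - ρ • (B w₀ - b)) = ρ • ((B w₀ - b) - (B w - b)) := by
    module
  rw [h2, norm_smul, Real.norm_eq_abs, mul_pow, sq_abs, norm_sub_sq_real]
  simp only [augLinLagrangian, linLagrangian] at h1 ⊢
  generalize B w - b = c at h1 ⊢
  generalize B w₀ - b = c₀ at h1 ⊢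
  rw [inner_sub_right, inner_sub_right, inner_smul_right, inner_smul_right,
    real_inner_self_eq_norm_sq, real_inner_comm c₀ c] at h1
  nlinarith

/-- If the Lagrangian subdifferential has an upper Lipschitz inverse, a feasible problem has a
saddle point. -/
theorem exists_saddle_point (hH : ConvexOn ℝ Set.univ H)
    (hattain : ∀ ρ : ℝ, 0 < ρ → ∀ α, ∃ w, ∀ y,
      augLinLagrangian H B b ρ w α ≤ augLinLagrangian H B b ρ y α) (hfeas : ∃ w, B w = b)
    {a ε : ℝ} (hε : 0 < ε) (hlip : ∀ q v, v ∈ saddleMap H B b q → ‖v‖ < ε →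
      ∃ q₀, 0 ∈ saddleMap H B b q₀ ∧ ‖q - q₀‖ ≤ a * ‖v‖) :
    ∃ q, 0 ∈ saddleMap H B b q := by
  obtain ⟨w₀, hw₀⟩ := hfeas
  obtain ⟨w₁, hw₁⟩ := hattain 1 one_pos 0
  have hgap : 0 ≤ H w₀ - augLinLagrangian H B b 1 w₁ 0 := by
    have := hw₁ w₀
    simp only [augLinLagrangian, linLagrangian, hw₀] at this ⊢
    simp at this ⊢
    linarith
  -- Penalty argument: with parameter `k + 1` and multiplier `0`, the extra penalty `k / 2 * ‖B w -
  -- b‖ ^ 2` is at most the fixed gap between `H w₀` and the minimum for parameter `1`. This `k`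
  -- pushes the residual below `ε`.
  obtain ⟨k, hk⟩ := exists_gt (2 * (H w₀ - augLinLagrangian H B b 1 w₁ 0) / ε ^ 2)
  have hk0 : 0 < k := lt_of_le_of_lt (by positivity) hk
  obtain ⟨w, hw⟩ := hattain (k + 1) (by positivity) 0
  have h1 := hw w₀
  have h2 := hw₁ w
  have hmin := linLagrangian_le_of_isMin_aug hH hw
  rw [div_lt_iff₀ (by positivity)] at hk
  generalize hm : augLinLagrangian H B b 1 w₁ 0 = m at *
  simp only [augLinLagrangian, linLagrangian, hw₀, inner_zero_right, sub_self, norm_zero] at h1 h2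
  have hsmall : ‖B w - b‖ < ε := by
    refine lt_of_pow_lt_pow_left₀ 2 hε.le ?_
    by_contra hcon
    nlinarith [mul_le_mul_of_nonneg_left (not_lt.1 hcon) hk0.le]
  obtain ⟨q₀, hq₀, -⟩ := hlip
    (WithLp.toLp 2 (w, 0 - (k + 1) • (B w - b))) (WithLp.toLp 2 (0, B w - b))
    (mem_saddleMap_iff.2 ⟨fun y => by simpa using hmin y, rfl⟩)
    (by simpa using hsmall)
  exact ⟨q₀, hq₀⟩

/-- The upper Lipschitz property passes from the Lagrangian to the dual. -/
theorem upper_lipschitz_negDual (hH : ConvexOn ℝ Set.univ H)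
    (hattain : ∀ ρ : ℝ, 0 < ρ → ∀ α, ∃ w, ∀ y,
      augLinLagrangian H B b ρ w α ≤ augLinLagrangian H B b ρ y α)
    {a ε : ℝ} (hlip : ∀ q v, v ∈ saddleMap H B b q → ‖v‖ < ε →
      ∃ q₀, 0 ∈ saddleMap H B b q₀ ∧ ‖q - q₀‖ ≤ a * ‖v‖) :
    ∀ α v, v ∈ subdifferential (negDual H B b) α → ‖v‖ < ε →
      ∃ β, 0 ∈ subdifferential (negDual H B b) β ∧ ‖α - β‖ ≤ a * ‖v‖ := by
  intro α v hv hvε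
  obtain ⟨w, hw, rfl⟩ := (mem_subdifferential_negDual_iff hH hattain).1 hv
  have hn : ‖(WithLp.toLp 2 ((0 : E), B w - b) : WithLp 2 (E × V))‖ = ‖B w - b‖ := by
    simp
  obtain ⟨q₀, hq₀, hle⟩ := hlip (WithLp.toLp 2 (w, α)) (WithLp.toLp 2 (0, B w - b))
    (mem_saddleMap_iff.2 ⟨fun y => by simpa using hw y, rfl⟩) (by rwa [hn])
  obtain ⟨h1, h2⟩ := zero_mem_saddleMap_iff.1 hq₀
  refine ⟨q₀.snd, ?_, ?_⟩
  · have := mem_subdifferential_negDual_of_isMin h1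
    rwa [h2, sub_self] at this
  · rw [hn] at hle
    refine le_trans ?_ hle
    exact WithLp.norm_snd_le _ (WithLp.toLp 2 (w, α) - q₀)

/-- The maximizers of the dual are the zeros of the subdifferential of its negative. -/
theorem neg_negDual_le_iff {β₀ : V} (hβ₀ : negDual H B b β₀ ≠ ⊤) {α : V} :
    (∀ β, - negDual H B b β ≤ - negDual H B b α) ↔
      (0 : V) ∈ subdifferential (negDual H B b) α := by
  simp only [EReal.neg_le_neg_iff, subdifferential, Set.mem_ofPred_eq, inner_zero_left,
    EReal.coe_zero, add_zero]
  exact ⟨fun h => ⟨ne_top_of_le_ne_top hβ₀ (h β₀), h⟩, fun h => h.2⟩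

/-- If nonempty, the zero set is the sublevel set at the minimal value, an intersection of closed
half-spaces, one for each `w`. -/
theorem isClosed_zeros_subdifferential_negDual :
    IsClosed {α : V | (0 : V) ∈ subdifferential (negDual H B b) α} := by
  rcases Set.eq_empty_or_nonempty {α : V | (0 : V) ∈ subdifferential (negDual H B b) α} with h | h
  · rw [h]; exact isClosed_empty
  obtain ⟨α₀, hα₀⟩ := h
  have hr : ((negDual H B b α₀).toReal : EReal) = negDual H B b α₀ :=
    EReal.coe_toReal hα₀.1
      (ne_bot_of_le_ne_bot (EReal.coe_ne_bot _) (neg_linLagrangian_le_negDual 0 α₀))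
  have hset : {α : V | (0 : V) ∈ subdifferential (negDual H B b) α} =
      {α | ∀ w, - linLagrangian H B b w α ≤ (negDual H B b α₀).toReal} := by
    ext α
    have hα₀' := hα₀.2
    simp only [inner_zero_left, EReal.coe_zero, add_zero] at hα₀'
    rw [Set.mem_ofPred_eq, ← neg_negDual_le_iff hα₀.1]
    simp only [EReal.neg_le_neg_iff, Set.mem_ofPred_eq, ← EReal.coe_le_coe_iff, hr]
    exact ⟨fun h w => (neg_linLagrangian_le_negDual w α).trans (h α₀),
      fun h β => (iSup_le h).trans (hα₀' β)⟩
  rw [hset]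
  simp only [Set.ofPred_forall, linLagrangian]
  exact isClosed_iInter fun w => isClosed_le (by fun_prop) continuous_const

end Duality

/-! ### The inexact proximal point method for a monotone map with an error bound. -/

section ProximalPoint

/-- Quasi-Fejér sequences of real numbers. -/
theorem le_exp_mul_of_le_one_add_mul {e η : ℕ → ℝ} (he : ∀ j, 0 ≤ e j) (hη : ∀ j, 0 ≤ η j)
    (hsum : Summable η) (h : ∀ j, e (j + 1) ≤ (1 + η j) * e j) :
    (∃ l, Tendsto e atTop (𝓝 l)) ∧ ∀ j m, j ≤ m → e m ≤ Real.exp (∑' i, η i) * e j := by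
  let S : ℕ → ℝ := fun j => ∑ i ∈ Finset.range j, η i
  have hS : Tendsto S atTop (𝓝 (∑' i, η i)) := hsum.hasSum.tendsto_sum_nat
  have hS0 : ∀ j, 0 ≤ S j := fun j => Finset.sum_nonneg fun i _ => hη i
  have hSle : ∀ j, S j ≤ ∑' i, η i := fun j => hsum.sum_le_tsum _ fun i _ => hη i
  -- Dividing by the exponential of the partial sums absorbs the growth factors and leaves a
  -- nonincreasing sequence.
  let f : ℕ → ℝ := fun j => e j * Real.exp (- S j)
  have hef : ∀ j, e j = f j * Real.exp (S j) := fun j => by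
    simp only [f]; rw [mul_assoc, ← Real.exp_add]; simp
  have hanti : Antitone f := antitone_nat_of_succ_le fun j => by
    have h1 : e (j + 1) ≤ Real.exp (η j) * e j :=
      (h j).trans (mul_le_mul_of_nonneg_right (by linarith [Real.add_one_le_exp (η j)]) (he j))
    calc e (j + 1) * Real.exp (- S (j + 1))
        ≤ Real.exp (η j) * e j * Real.exp (- S (j + 1)) :=
          mul_le_mul_of_nonneg_right h1 (Real.exp_pos _).le
      _ = e j * Real.exp (- S j) := by
          have : - S j = η j + - S (j + 1) := by simp only [S, Finset.sum_range_succ]; ring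
          rw [this, Real.exp_add]; ring
  refine ⟨?_, fun j m hjm => ?_⟩
  · have hbdd : BddBelow (Set.range f) :=
      ⟨0, by rintro _ ⟨j, rfl⟩; exact mul_nonneg (he j) (Real.exp_pos _).le⟩
    refine ⟨_, ((tendsto_atTop_ciInf hanti hbdd).mul
      ((Real.continuous_exp.tendsto _).comp hS)).congr fun j => (hef j).symm⟩
  · calc e m = f m * Real.exp (S m) := hef m
      _ ≤ f j * Real.exp (S m) := mul_le_mul_of_nonneg_right (hanti hjm) (Real.exp_pos _).le
      _ ≤ e j * Real.exp (∑' i, η i) := by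
          refine mul_le_mul ?_ (Real.exp_le_exp.2 (hSle m)) (Real.exp_pos _).le (he j)
          exact mul_le_of_le_one_right (he j) (Real.exp_le_one_iff.2 (neg_nonpos.2 (hS0 j)))
      _ = _ := mul_comm _ _

variable {V : Type*} [NormedAddCommGroup V] [InnerProductSpace ℝ V]

/-- The proximal point of a monotone map is closer to each zero. -/
theorem norm_sub_sq_add_le_of_monotone {T : V → Set V}
    (hmono : ∀ x y u v, u ∈ T x → v ∈ T y → 0 ≤ ⟪u - v, x - y⟫_ℝ) {ρ : ℝ} (hρ : 0 < ρ) {α β ω : V}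
    (hβ : (1 / ρ) • (α - β) ∈ T β) (hω : 0 ∈ T ω) :
    ‖β - ω‖ ^ 2 + ‖α - β‖ ^ 2 ≤ ‖α - ω‖ ^ 2 := by
  have h := hmono _ _ _ _ hβ hω
  rw [sub_zero, real_inner_smul_left] at h
  have h1 : 0 ≤ ⟪α - β, β - ω⟫_ℝ := nonneg_of_mul_nonneg_right h (by positivity)
  rw [← sub_add_sub_cancel α β ω, norm_add_sq_real]
  linarith

/-- An inexact proximal point sequence of a map `T`: `β j` is the exact proximal point of `α j`. -/
structure IsInexactProximalSequence (T : V → Set V) (ρ κ : ℕ → ℝ) (α β : ℕ → V) : Prop where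
  ρ_pos : ∀ j, 0 < ρ j
  κ_nonneg : ∀ j, 0 ≤ κ j
  κ_summable : Summable κ
  prox : ∀ j, (1 / ρ j) • (α j - β j) ∈ T (β j)
  error : ∀ j, ‖α (j + 1) - β j‖ ≤ κ j * ‖α (j + 1) - α j‖

namespace IsInexactProximalSequence

variable {T : V → Set V} {ρ κ : ℕ → ℝ} {α β : ℕ → V}

theorem shift (h : IsInexactProximalSequence T ρ κ α β) (N : ℕ) :
    IsInexactProximalSequence T (fun j => ρ (j + N)) (fun j => κ (j + N)) (fun j => α (j + N))
      (fun j => β (j + N)) where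
  ρ_pos j := h.ρ_pos _
  κ_nonneg j := h.κ_nonneg _
  κ_summable := (summable_nat_add_iff N).2 h.κ_summable
  prox j := h.prox _
  error j := by
    have := h.error (j + N)
    rwa [show j + N + 1 = j + 1 + N by ring] at this

/-- The tolerance is relative to the step actually taken, which involves the error itself; solving
for the step produces the factor `1 - κ j`. -/
theorem step_le (h : IsInexactProximalSequence T ρ κ α β) (j : ℕ) :
    (1 - κ j) * ‖α (j + 1) - α j‖ ≤ ‖α j - β j‖ := by
  have h1 := h.error j
  have h2 : ‖α (j + 1) - α j‖ ≤ ‖α (j + 1) - β j‖ + ‖α j - β j‖ := by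
    rw [norm_sub_rev (α j) (β j)]
    exact norm_sub_le_norm_sub_add_norm_sub _ _ _
  linarith

variable (hmono : ∀ x y u v, u ∈ T x → v ∈ T y → 0 ≤ ⟪u - v, x - y⟫_ℝ)
include hmono

theorem norm_prox_sub_le (h : IsInexactProximalSequence T ρ κ α β) {ω : V} (hω : 0 ∈ T ω) (j : ℕ) :
    ‖β j - ω‖ ≤ ‖α j - ω‖ ∧ ‖α j - β j‖ ≤ ‖α j - ω‖ := by
  have := norm_sub_sq_add_le_of_monotone hmono (h.ρ_pos j) (h.prox j) hω
  exact ⟨le_of_pow_le_pow_left₀ two_ne_zero (norm_nonneg _) (by linarith [sq_nonneg ‖α j - β j‖]),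
    le_of_pow_le_pow_left₀ two_ne_zero (norm_nonneg _) (by linarith [sq_nonneg ‖β j - ω‖])⟩

theorem error_le (h : IsInexactProximalSequence T ρ κ α β) {ω : V} (hω : 0 ∈ T ω) {j : ℕ}
    (hκ : κ j < 1) : ‖α (j + 1) - β j‖ ≤ κ j / (1 - κ j) * ‖α j - ω‖ := by
  have h1 := h.step_le j
  have h2 := (h.norm_prox_sub_le hmono hω j).2
  have h3 : ‖α (j + 1) - α j‖ ≤ ‖α j - ω‖ / (1 - κ j) := by
    rw [le_div_iff₀ (by linarith)]; linarith
  calc _ ≤ κ j * ‖α (j + 1) - α j‖ := h.error j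
    _ ≤ κ j * (‖α j - ω‖ / (1 - κ j)) := mul_le_mul_of_nonneg_left h3 (h.κ_nonneg j)
    _ = _ := by ring

/-- With `κ j ≤ 1 / 2` the factor `κ j / (1 - κ j)` is at most `2 * κ j`, which is summable. -/
theorem quasi_fejer (h : IsInexactProximalSequence T ρ κ α β) (hκ : ∀ j, κ j ≤ 1 / 2) {ω : V}
    (hω : 0 ∈ T ω) (j : ℕ) :
    ‖α (j + 1) - ω‖ ≤ ‖β j - ω‖ + 2 * κ j * ‖α j - ω‖ := by
  have h1 := h.error_le hmono hω (j := j) (by linarith [hκ j])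
  have h2 : κ j / (1 - κ j) ≤ 2 * κ j := by
    rw [div_le_iff₀ (by linarith [hκ j])]
    nlinarith [hκ j, h.κ_nonneg j]
  have h3 := mul_le_mul_of_nonneg_right h2 (norm_nonneg (α j - ω))
  have h4 : ‖α (j + 1) - ω‖ ≤ ‖α (j + 1) - β j‖ + ‖β j - ω‖ :=
    norm_sub_le_norm_sub_add_norm_sub _ _ _
  linarith

theorem quasi_fejer_mul (h : IsInexactProximalSequence T ρ κ α β) (hκ : ∀ j, κ j ≤ 1 / 2) {ω : V}
    (hω : 0 ∈ T ω) (j : ℕ) :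
    ‖α (j + 1) - ω‖ ≤ (1 + 2 * κ j) * ‖α j - ω‖ := by
  have h1 := h.quasi_fejer hmono hκ hω j
  have h2 := (h.norm_prox_sub_le hmono hω j).1
  linarith

/-- The distances from `α j` to `ω` converge, and those from `β j` are squeezed to the same limit;
the drop in squared distance, which bounds `‖α j - β j‖ ^ 2`, therefore vanishes. -/
theorem tendsto_sub_prox_of_le (h : IsInexactProximalSequence T ρ κ α β) (hκ : ∀ j, κ j ≤ 1 / 2)
    {ω : V} (hω : 0 ∈ T ω) : Tendsto (fun j => ‖α j - β j‖) atTop (𝓝 0) := by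
  obtain ⟨⟨l, hl⟩, -⟩ := le_exp_mul_of_le_one_add_mul (fun j => norm_nonneg (α j - ω))
    (fun j => mul_nonneg zero_le_two (h.κ_nonneg j)) (h.κ_summable.mul_left 2)
    (h.quasi_fejer_mul hmono hκ hω)
  have hκ0 := h.κ_summable.tendsto_atTop_zero
  have hβ : Tendsto (fun j => ‖β j - ω‖) atTop (𝓝 l) := by
    have hlow : Tendsto (fun j => ‖α (j + 1) - ω‖ - 2 * κ j * ‖α j - ω‖) atTop (𝓝 l) := by
      have := ((tendsto_add_atTop_iff_nat 1).2 hl).sub ((hκ0.const_mul 2).mul hl)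
      simpa using this
    exact tendsto_of_tendsto_of_tendsto_of_le_of_le hlow hl
      (fun j => by linarith [h.quasi_fejer hmono hκ hω j])
      (fun j => (h.norm_prox_sub_le hmono hω j).1)
  have hsq : Tendsto (fun j => ‖α j - β j‖ ^ 2) atTop (𝓝 0) := by
    refine squeeze_zero (fun j => sq_nonneg _)
      (g := fun j => ‖α j - ω‖ ^ 2 - ‖β j - ω‖ ^ 2) (fun j => ?_) ?_
    · linarith [norm_sub_sq_add_le_of_monotone hmono (h.ρ_pos j) (h.prox j) hω]
    · simpa using (hl.pow 2).sub (hβ.pow 2)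
  have := (Real.continuous_sqrt.tendsto 0).comp hsq
  simpa only [Function.comp_def, Real.sqrt_sq (norm_nonneg _), Real.sqrt_zero] using this

theorem tendsto_sub_prox (h : IsInexactProximalSequence T ρ κ α β) {ω : V} (hω : 0 ∈ T ω) :
    Tendsto (fun j => ‖α j - β j‖) atTop (𝓝 0) := by
  have hκ0 := h.κ_summable.tendsto_atTop_zero
  obtain ⟨N, hN⟩ := eventually_atTop.1 (hκ0.eventually_le_const (by norm_num : (0 : ℝ) < 1 / 2))
  rw [← tendsto_add_atTop_iff_nat N]
  exact (h.shift N).tendsto_sub_prox_of_le hmono (fun j => hN _ (by omega)) hω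

variable {a : ℝ} (hT : HasErrorBoundAtOrigin T a) {δ : ℝ} (hδ : 0 < δ) (hρ : ∀ᶠ j in atTop, δ ≤ ρ j)
include hT hδ hρ

/-- The residual `(α j - β j) / ρ j` lies in `T (β j)`. As `ρ` stays away from `0`, it eventually
enters the range where the error bound holds. -/
theorem eventually_infDist_prox_le (h : IsInexactProximalSequence T ρ κ α β) {ω : V}
    (hω : 0 ∈ T ω) :
    ∀ᶠ j in atTop, Metric.infDist (β j) {q | 0 ∈ T q} ≤ a * (‖α j - β j‖ / ρ j) := by
  obtain ⟨ε, hε, hbound⟩ := hT.exists_infDist_le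
  have h1 := (h.tendsto_sub_prox hmono hω).eventually_lt_const (by positivity : 0 < ε * δ)
  filter_upwards [h1, hρ] with j hj hρj
  have hn : ‖(1 / ρ j) • (α j - β j)‖ = ‖α j - β j‖ / ρ j := by
    rw [norm_smul, Real.norm_eq_abs, abs_of_pos (one_div_pos.2 (h.ρ_pos j))]; ring
  have := hbound _ _ (h.prox j) (by
    rw [hn, div_lt_iff₀ (h.ρ_pos j)]
    exact hj.trans_le (mul_le_mul_of_nonneg_left hρj hε.le))
  rwa [hn] at this

theorem tendsto_infDist_zero (h : IsInexactProximalSequence T ρ κ α β) {ω : V} (hω : 0 ∈ T ω) :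
    Tendsto (fun j => Metric.infDist (α j) {q | 0 ∈ T q}) atTop (𝓝 0) := by
  have h0 := h.tendsto_sub_prox hmono hω
  have hlim : Tendsto (fun j => ‖α j - β j‖ + a * (‖α j - β j‖ / δ)) atTop (𝓝 0) := by
    simpa using h0.add ((h0.div_const δ).const_mul a)
  refine squeeze_zero' (Eventually.of_forall fun j => Metric.infDist_nonneg) ?_ hlim
  filter_upwards [h.eventually_infDist_prox_le hmono hT hδ hρ hω, hρ] with j hj hρj
  have h1 : Metric.infDist (α j) {q | 0 ∈ T q} ≤
      Metric.infDist (β j) {q | 0 ∈ T q} + dist (α j) (β j) := Metric.infDist_le_infDist_add_dist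
  have h2 : a * (‖α j - β j‖ / ρ j) ≤ a * (‖α j - β j‖ / δ) := by
    have := hT.1
    gcongr
  rw [dist_eq_norm] at h1
  linarith

/-- The inexact proximal point method converges to a zero. -/
theorem exists_tendsto [CompleteSpace V] (h : IsInexactProximalSequence T ρ κ α β)
    (hclosed : IsClosed {q | 0 ∈ T q}) {ω : V} (hω : 0 ∈ T ω) :
    ∃ ω', 0 ∈ T ω' ∧ Tendsto α atTop (𝓝 ω') := by
  have hκ0 := h.κ_summable.tendsto_atTop_zero
  obtain ⟨N, hN⟩ := eventually_atTop.1 (hκ0.eventually_le_const (by norm_num : (0 : ℝ) < 1 / 2))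
  have hd := h.tendsto_infDist_zero hmono hT hδ hρ hω
  have hs := h.shift N
  have hfejer := fun ω' (hω' : 0 ∈ T ω') =>
    (le_exp_mul_of_le_one_add_mul (fun j => norm_nonneg (α (j + N) - ω'))
      (fun j => mul_nonneg zero_le_two (hs.κ_nonneg j)) (hs.κ_summable.mul_left 2)
      (hs.quasi_fejer_mul hmono (fun j => hN _ (by omega)) hω')).2
  generalize Real.exp (∑' i, 2 * κ (i + N)) = K at hfejer
  have hne : {q | 0 ∈ T q}.Nonempty := ⟨ω, hω⟩
  -- Once an iterate is close to some zero, quasi-Fejér monotonicity keeps all later iterates within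
  -- `K` times that distance of the same zero. No compactness is needed.
  have hcauchy : CauchySeq fun j => α (j + N) := by
    rw [Metric.cauchySeq_iff']
    intro ε hε
    have hK : 0 < |K| + 1 := by positivity
    have hd' := ((tendsto_add_atTop_iff_nat N).2 hd).eventually_lt_const
      (by positivity : 0 < ε / (|K| + 1))
    obtain ⟨n, hn⟩ := hd'.exists
    obtain ⟨ω', hω', hlt⟩ := (Metric.infDist_lt_iff hne).1 hn
    refine ⟨n, fun m hm => ?_⟩
    rw [dist_eq_norm, lt_div_iff₀ hK] at hlt
    have h1 := hfejer ω' hω' n m hm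
    have h2 : ‖α (m + N) - α (n + N)‖ ≤ ‖α (m + N) - ω'‖ + ‖α (n + N) - ω'‖ := by
      rw [norm_sub_rev (α (n + N)) ω']
      exact norm_sub_le_norm_sub_add_norm_sub _ _ _
    rw [dist_eq_norm]
    nlinarith [mul_le_mul_of_nonneg_right (le_abs_self K) (norm_nonneg (α (n + N) - ω'))]
  obtain ⟨ω', hω'⟩ := cauchySeq_tendsto_of_complete hcauchy
  have hlim := (tendsto_add_atTop_iff_nat N).1 hω'
  refine ⟨ω', ?_, hlim⟩
  have h0 : Metric.infDist ω' {q | 0 ∈ T q} = 0 :=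
    tendsto_nhds_unique (((Metric.continuous_infDist_pt _).tendsto ω').comp hlim) hd
  exact (hclosed.mem_iff_infDist_zero hne).2 h0

/-- The asymptotic linear rate of the inexact proximal point method. -/
theorem eventually_infDist_le [ProperSpace V] (h : IsInexactProximalSequence T ρ κ α β)
    (hclosed : IsClosed {q | 0 ∈ T q}) {ω : V} (hω : 0 ∈ T ω) :
    ∀ᶠ j in atTop, Metric.infDist (α (j + 1)) {q | 0 ∈ T q} ≤
      (a / √(a ^ 2 + ρ j ^ 2) + 2 * κ j / (1 - κ j)) * Metric.infDist (α j) {q | 0 ∈ T q} := by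
  have hκ0 := h.κ_summable.tendsto_atTop_zero
  filter_upwards [h.eventually_infDist_prox_le hmono hT hδ hρ hω,
    hκ0.eventually_lt_const one_pos] with j hj hκ
  have hρj := h.ρ_pos j
  obtain ⟨ω', hω', hdist⟩ := hclosed.exists_infDist_eq_dist ⟨ω, hω⟩ (α j)
  rw [dist_eq_norm] at hdist
  have hfirm := norm_sub_sq_add_le_of_monotone hmono hρj (h.prox j) hω'
  have herr := h.error_le hmono hω' hκ
  have htri : Metric.infDist (α (j + 1)) {q | 0 ∈ T q} ≤
      Metric.infDist (β j) {q | 0 ∈ T q} + dist (α (j + 1)) (β j) :=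
    Metric.infDist_le_infDist_add_dist
  have hβω : Metric.infDist (β j) {q | 0 ∈ T q} ≤ ‖β j - ω'‖ := by
    rw [← dist_eq_norm]; exact Metric.infDist_le_dist_of_mem hω'
  have hnn : 0 ≤ Metric.infDist (β j) {q | 0 ∈ T q} := Metric.infDist_nonneg
  rw [dist_eq_norm] at htri
  rw [← hdist] at hfirm herr
  generalize Metric.infDist (β j) {q | 0 ∈ T q} = d' at *
  generalize Metric.infDist (α (j + 1)) {q | 0 ∈ T q} = d'' at *
  have hd0 : 0 ≤ Metric.infDist (α j) {q | 0 ∈ T q} := Metric.infDist_nonneg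
  generalize Metric.infDist (α j) {q | 0 ∈ T q} = d at *
  have ha := hT.1
  -- With `s = ‖α j - β j‖`, the error bound gives `ρ² d'² ≤ a² s²` and the proximal inequality at
  -- the nearest zero gives `d'² + s² ≤ d²`. Eliminating `s` leaves `(a² + ρ²) d'² ≤ a² d²`.
  have hprox : d' ≤ a / √(a ^ 2 + ρ j ^ 2) * d := by
    rw [div_mul_eq_mul_div, le_div_iff₀ (by positivity)]
    refine le_of_pow_le_pow_left₀ two_ne_zero (by positivity) ?_
    rw [mul_pow, Real.sq_sqrt (by positivity), mul_pow]
    have h1 : d' ^ 2 * ρ j ^ 2 ≤ a ^ 2 * ‖α j - β j‖ ^ 2 := by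
      rw [← mul_pow, ← mul_pow]
      refine pow_le_pow_left₀ (by positivity) ?_ 2
      calc d' * ρ j ≤ a * (‖α j - β j‖ / ρ j) * ρ j := mul_le_mul_of_nonneg_right hj hρj.le
        _ = a * ‖α j - β j‖ := by field_simp
    have h2 : d' ^ 2 ≤ ‖β j - ω'‖ ^ 2 := pow_le_pow_left₀ hnn hβω 2
    nlinarith [mul_le_mul_of_nonneg_left (add_le_add_left h2 (‖α j - β j‖ ^ 2)) (sq_nonneg a),
      mul_le_mul_of_nonneg_left hfirm (sq_nonneg a)]
  -- The argument loses only `κ j / (1 - κ j)`; the factor 2 in the stated rate is slack.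
  have hκ' : κ j / (1 - κ j) * d ≤ 2 * κ j / (1 - κ j) * d := by
    refine mul_le_mul_of_nonneg_right ?_ hd0
    exact div_le_div_of_nonneg_right (by linarith [h.κ_nonneg j]) (by linarith)
  rw [add_mul]
  linarith

end IsInexactProximalSequence

end ProximalPoint

/-! ### Proximal points and the gradient of the Moreau envelope. -/

section MoreauEnvelope

theorem IsProx.moreauEnvelope_eq {E : Type*} [NormedAddCommGroup E] {q : E → ℝ} {x P : E}
    (hP : IsProx q x P) :
    moreauEnvelope q x = q P + (1 / 2) * ‖P - x‖ ^ 2 :=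
  le_antisymm (ciInf_le ⟨_, by rintro _ ⟨y, rfl⟩; exact hP y⟩ P) (le_ciInf hP)

variable {E : Type*} [NormedAddCommGroup E] [InnerProductSpace ℝ E] {q : E → ℝ} {x P : E}

theorem IsProx.subgradient (hq : ConvexOn ℝ Set.univ q) (hP : IsProx q x P) (y : E) :
    q P + ⟪x - P, y - P⟫_ℝ ≤ q y := by
  rw [← sub_nonpos]
  refine nonpos_of_forall_le_mul (k := 1 / 2 * ‖y - P‖ ^ 2) one_pos fun t ht ht1 => ?_
  have h1 := hP (P + t • (y - P))
  have h2 := hq.2 (Set.mem_univ P) (Set.mem_univ y) (sub_nonneg.2 ht1) ht.le (by ring)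
  have h3 : (1 - t) • P + t • y = P + t • (y - P) := by module
  have h4 : P + t • (y - P) - x = t • (y - P) - (x - P) := by abel
  rw [h3, smul_eq_mul, smul_eq_mul] at h2
  rw [h4, norm_sub_sq_real (t • (y - P)) (x - P), norm_smul, Real.norm_eq_abs, mul_pow, sq_abs, real_inner_smul_left,
    norm_sub_rev P x, real_inner_comm (x - P) (y - P)] at h1
  by_contra hcon
  nlinarith [mul_pos ht (sub_pos.2 (not_le.1 hcon))]

/-- The Moreau-Yosida regularization of a convex function is differentiable. -/
theorem IsProx.hasGradientAt_moreauEnvelope [CompleteSpace E] (hq : ConvexOn ℝ Set.univ q)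
    (hP : IsProx q x P) : HasGradientAt (moreauEnvelope q) (x - P) x := by
  -- The envelope lies between its linearization and the linearization plus `‖y - x‖ ^ 2 / 2`. The
  -- lower bound combines the subgradient `x - P` of `q` at `P` with a completed square; the upper
  -- one uses `P` as competitor at `y`.
  have hlow : ∀ y v, moreauEnvelope q x + ⟪x - P, y - x⟫_ℝ ≤ q v + (1 / 2) * ‖v - y‖ ^ 2 := by
    intro y v
    have h1 := hP.subgradient hq v
    have h2 : v - P = (v - y) + (y - x) + (x - P) := by abel
    have h3 := sq_nonneg ‖(v - y) + (x - P)‖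
    rw [norm_add_sq_real, real_inner_comm] at h3
    rw [hP.moreauEnvelope_eq, norm_sub_rev P x]
    rw [h2, inner_add_right, inner_add_right, real_inner_self_eq_norm_sq] at h1
    linarith
  have hup : ∀ y, moreauEnvelope q y ≤
      moreauEnvelope q x + ⟪x - P, y - x⟫_ℝ + 1 / 2 * ‖y - x‖ ^ 2 := by
    intro y
    refine (ciInf_le ⟨_, by rintro _ ⟨v, rfl⟩; exact hlow y v⟩ P).trans (le_of_eq ?_)
    have h2 : P - y = - ((x - P) + (y - x)) := by abel
    rw [hP.moreauEnvelope_eq, norm_sub_rev P x, h2, norm_neg, norm_add_sq_real]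
    ring
  rw [hasGradientAt_iff_isLittleO]
  refine (Asymptotics.IsBigO.of_bound (1 / 2) (Eventually.of_forall fun y => ?_)).trans_isLittleO
    (Asymptotics.isLittleO_pow_sub_sub x (m := 2) one_lt_two)
  have h1 : moreauEnvelope q x + ⟪x - P, y - x⟫_ℝ ≤ moreauEnvelope q y := le_ciInf (hlow y)
  rw [Real.norm_eq_abs, abs_of_nonneg (by linarith), norm_pow, norm_norm]
  linarith [hup y]

end MoreauEnvelope

/-! ### Coercivity and existence of minimizers. -/

section Attainment

variable {E W : Type*} [NormedAddCommGroup E] [InnerProductSpace ℝ E] [FiniteDimensional ℝ E]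
  [NormedAddCommGroup W] [InnerProductSpace ℝ W]

/-- Outside the unit ball, `w / ‖w‖` lies between `0` and `w`, so convexity turns the minimum over
the ball into a linear lower bound. -/
theorem ConvexOn.exists_linear_lower_bound {F : E → ℝ} (hF : ConvexOn ℝ Set.univ F) :
    ∃ M N : ℝ, 0 ≤ M ∧ 0 ≤ N ∧ ∀ w, - M - N * ‖w‖ ≤ F w := by
  obtain ⟨e₀, -, he₀⟩ := (isCompact_closedBall (0 : E) 1).exists_isMinOn
    ⟨0, by simp⟩ hF.continuous_of_univ.continuousOn
  refine ⟨|F e₀|, |F e₀| + |F 0|, by positivity, by positivity, fun w => ?_⟩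
  have hball : ∀ e : E, ‖e‖ ≤ 1 → - |F e₀| ≤ F e := fun e he =>
    (neg_abs_le _).trans (he₀ (by simpa using he))
  rcases le_total ‖w‖ 1 with hw | hw
  · have : 0 ≤ (|F e₀| + |F 0|) * ‖w‖ := by positivity
    linarith [hball w hw]
  · have hpos : 0 < ‖w‖ := by linarith
    have h1 := hball (‖w‖⁻¹ • w) (by rw [norm_smul, norm_inv, norm_norm, inv_mul_cancel₀ hpos.ne'])
    have h2 := hF.2 (Set.mem_univ 0) (Set.mem_univ w) (sub_nonneg.2 (inv_le_one_of_one_le₀ hw))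
      (inv_nonneg.2 hpos.le) (by ring)
    rw [smul_zero, zero_add, smul_eq_mul, smul_eq_mul] at h2
    have h3 := mul_le_mul_of_nonneg_left (h1.trans h2) hpos.le
    have h4 : ‖w‖ * ((1 - ‖w‖⁻¹) * F 0 + ‖w‖⁻¹ * F w) = (‖w‖ - 1) * F 0 + F w := by
      field_simp
    rw [h4] at h3
    have h5 : (‖w‖ - 1) * F 0 ≤ ‖w‖ * |F 0| := by
      calc (‖w‖ - 1) * F 0 ≤ (‖w‖ - 1) * |F 0| :=
            mul_le_mul_of_nonneg_left (le_abs_self _) (by linarith)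
        _ ≤ ‖w‖ * |F 0| := mul_le_mul_of_nonneg_right (by linarith) (abs_nonneg _)
    have := abs_nonneg (F e₀)
    linarith

/-- The sum of a convex function and a positive definite quadratic function has a minimizer. -/
theorem ConvexOn.exists_isMin_add_norm_sq {F : E → ℝ} (hF : ConvexOn ℝ Set.univ F)
    (T : E →L[ℝ] W) (hT : Function.Injective T) (t : W) :
    ∃ w, ∀ y, F w + ‖T w - t‖ ^ 2 ≤ F y + ‖T y - t‖ ^ 2 := by
  obtain ⟨M, N, hM, hN, hbound⟩ := hF.exists_linear_lower_bound
  obtain ⟨K, hK, hanti⟩ := (T : E →ₗ[ℝ] W).exists_antilipschitzWith (LinearMap.ker_eq_bot.2 hT)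
  have hK' : (0 : ℝ) < K := hK
  have hTw : ∀ w, ‖w‖ ≤ K * ‖T w‖ := fun w => by
    simpa using hanti.le_mul_dist w 0
  have hcont : Continuous fun w => F w + ‖T w - t‖ ^ 2 := by
    have := hF.continuous_of_univ
    fun_prop
  let f₀ := F 0 + ‖T 0 - t‖ ^ 2
  -- Beyond this radius the quadratic growth `‖w‖² / K²` beats the linear terms; `R ≥ 1` lets the
  -- constants be absorbed into multiples of `‖w‖`.
  let R := max 1 (K ^ 2 * (|f₀| + M + N + 2 * (1 / K) * ‖t‖))
  have hev : ∀ᶠ w in cocompact E, R ≤ ‖w‖ := (tendsto_norm_cocompact_atTop).eventually_ge_atTop R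
  refine hcont.exists_forall_le' 0 ?_
  filter_upwards [hev] with w hw
  have h1 : 1 ≤ ‖w‖ := (le_max_left _ _).trans hw
  have h2 := (le_max_right _ _).trans hw
  have h3 : ‖w‖ / K ≤ ‖T w‖ := by rw [div_le_iff₀ hK']; linarith [hTw w]
  have h4 : ‖T w‖ - ‖t‖ ≤ ‖T w - t‖ := norm_sub_norm_le _ _
  have h5 : (‖w‖ / K) ^ 2 - 2 * (‖w‖ / K) * ‖t‖ ≤ ‖T w - t‖ ^ 2 := by
    have hwk : 0 ≤ ‖w‖ / K := by positivity
    rcases le_total (‖w‖ / K) ‖t‖ with h | h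
    · nlinarith [sq_nonneg ‖T w - t‖, norm_nonneg t]
    · nlinarith [norm_nonneg t, norm_nonneg (T w - t)]
  have h6 : |f₀| + M + N + 2 * (1 / K) * ‖t‖ ≤ ‖w‖ / K ^ 2 := by
    rw [le_div_iff₀ (by positivity)]; linarith
  have h7 : (‖w‖ / K) ^ 2 - 2 * (‖w‖ / K) * ‖t‖ = ‖w‖ * (‖w‖ / K ^ 2 - 2 * (1 / K) * ‖t‖) := by
    field_simp
  have h8 : ‖w‖ * (|f₀| + M + N) ≤ ‖w‖ * (‖w‖ / K ^ 2 - 2 * (1 / K) * ‖t‖) :=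
    mul_le_mul_of_nonneg_left (by linarith) (by linarith)
  have h9 : |f₀| + M ≤ ‖w‖ * (|f₀| + M) := le_mul_of_one_le_left (by positivity) h1
  have h10 := hbound w
  have h11 : f₀ ≤ |f₀| := le_abs_self _
  change f₀ ≤ _
  nlinarith

end Attainment

/-! ### Scaling, conjugates and extended-real suprema. -/

section Auxiliary

theorem ConvexOn.const_mul_of_pos {E : Type*} [NormedAddCommGroup E] [InnerProductSpace ℝ E]
    {g : E → ℝ} (hg : ConvexOn ℝ Set.univ g) {c : ℝ} (hc : 0 < c) :
    ConvexOn ℝ Set.univ fun y => c * g y :=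
  hg.smul hc.le

theorem IsProx.scaled_subgradient {E : Type*} [NormedAddCommGroup E] [InnerProductSpace ℝ E]
    {g : E → ℝ} (hg : ConvexOn ℝ Set.univ g) {ρ : ℝ} (hρ : 0 < ρ) {y P : E}
    (hP : IsProx (fun v => 1 / ρ * g v) y P) (v : E) :
    g P + ⟪ρ • (y - P), v - P⟫_ℝ ≤ g v := by
  have h := mul_le_mul_of_nonneg_left
    (hP.subgradient (hg.const_mul_of_pos (one_div_pos.2 hρ)) v) hρ.le
  simp only [mul_add, ← mul_assoc, mul_one_div_cancel hρ.ne', one_mul] at h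
  rwa [real_inner_smul_left]

theorem norm_toLp_le {E V : Type*} [NormedAddCommGroup E] [NormedAddCommGroup V] (w : E) (v : V) :
    ‖(WithLp.toLp 2 (w, v) : WithLp 2 (E × V))‖ ≤ ‖w‖ + ‖v‖ := by
  have h : (WithLp.toLp 2 (w, v) : WithLp 2 (E × V)) =
      WithLp.toLp 2 (w, 0) + WithLp.toLp 2 (0, v) := by
    rw [← WithLp.toLp_add, Prod.mk_add_mk, add_zero, zero_add]
  rw [h]
  exact (norm_add_le _ _).trans (by rw [WithLp.norm_toLp_fst, WithLp.norm_toLp_snd])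

/-- Fenchel-Young inequality for the proximal term, by completing the square; it accounts for the
explicit quadratic part of `φ`. -/
theorem inner_sub_sq_le {E : Type*} [NormedAddCommGroup E] [InnerProductSpace ℝ E] {σ : ℝ}
    (hσ : 0 < σ) (s y y₀ : E) :
    ⟪s, y⟫_ℝ - 1 / (2 * σ) * ‖y - y₀‖ ^ 2 ≤ σ / 2 * ‖s‖ ^ 2 + ⟪y₀, s⟫_ℝ := by
  have h := sq_nonneg ‖σ • s - (y - y₀)‖
  rw [norm_sub_sq_real, norm_smul, Real.norm_eq_abs, mul_pow, sq_abs, real_inner_smul_left,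
    inner_sub_right, real_inner_comm y₀ s] at h
  have h2 : σ / 2 * ‖s‖ ^ 2 + ⟪y₀, s⟫_ℝ - (⟪s, y⟫_ℝ - 1 / (2 * σ) * ‖y - y₀‖ ^ 2) =
      1 / (2 * σ) * (σ ^ 2 * ‖s‖ ^ 2 - 2 * (σ * (⟪s, y⟫_ℝ - ⟪y₀, s⟫_ℝ)) + ‖y - y₀‖ ^ 2) := by
    field_simp
    ring
  have h3 : 0 ≤ 1 / (2 * σ) * (σ ^ 2 * ‖s‖ ^ 2 - 2 * (σ * (⟪s, y⟫_ℝ - ⟪y₀, s⟫_ℝ)) +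
      ‖y - y₀‖ ^ 2) := mul_nonneg (by positivity) h
  linarith

theorem coe_le_conjugateFun {E : Type*} [NormedAddCommGroup E] [InnerProductSpace ℝ E] (g : E → ℝ)
    (v u : E) : ((⟪v, u⟫_ℝ - g u : ℝ) : EReal) ≤ conjugateFun g v :=
  le_iSup (fun u => ((⟪v, u⟫_ℝ - g u : ℝ) : EReal)) u

/-- Splits a supremum over independent variables. When `S` is real, fixing one index bounds the
other family, so both suprema are real and can be treated separately. -/
theorem EReal.coe_add_iSup_add_iSup_le {ι κ : Type*} [Nonempty ι] [Nonempty κ] {c : ℝ} {a : ι → ℝ}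
    {b : κ → ℝ} {S : EReal} (h : ∀ i k, ((c + a i + b k : ℝ) : EReal) ≤ S) :
    (c : EReal) + (⨆ i, (a i : EReal)) + (⨆ k, (b k : EReal)) ≤ S := by
  obtain ⟨i₀⟩ := ‹Nonempty ι›
  obtain ⟨k₀⟩ := ‹Nonempty κ›
  induction S with
  | bot => exact absurd (h i₀ k₀) (by simp only [le_bot_iff]; exact EReal.coe_ne_bot _)
  | top => exact le_top
  | coe r =>
    simp only [EReal.coe_le_coe_iff] at h
    have ha : (⨆ i, (a i : EReal)) ≤ ((⨆ i, a i : ℝ) : EReal) := iSup_le fun i =>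
      EReal.coe_le_coe_iff.2 (le_ciSup ⟨r - c - b k₀, by
        rintro _ ⟨i, rfl⟩; linarith [h i k₀]⟩ i)
    have hb : (⨆ k, (b k : EReal)) ≤ ((⨆ k, b k : ℝ) : EReal) := iSup_le fun k =>
      EReal.coe_le_coe_iff.2 (le_ciSup ⟨r - c - a i₀, by
        rintro _ ⟨k, rfl⟩; linarith [h i₀ k]⟩ k)
    refine (add_le_add (add_le_add le_rfl ha) hb).trans ?_
    rw [← EReal.coe_add, ← EReal.coe_add, EReal.coe_le_coe_iff]
    have : Nonempty ι := ⟨i₀⟩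
    have : Nonempty κ := ⟨k₀⟩
    have h1 : (⨆ k, b k) ≤ r - c - ⨆ i, a i := ciSup_le fun k => by
      have : (⨆ i, a i) ≤ r - c - b k := ciSup_le fun i => by linarith [h i k]
      linarith
    linarith

theorem convexOn_norm_sub_sq {E : Type*} [NormedAddCommGroup E] [InnerProductSpace ℝ E] (y₀ : E) :
    ConvexOn ℝ Set.univ (fun y => ‖y - y₀‖ ^ 2) := by
  simp only [← dist_eq_norm]
  exact (convexOn_univ_dist y₀).pow (fun _ _ => dist_nonneg) 2

end Auxiliary

/-! ### The subproblem as a linearly constrained convex problem: duality, attainment, uniqueness. -/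

namespace ProxSubproblem

variable {n p : ℕ} (D : ProxSubproblem n p)

/-- The coordinate `x` of `(x, u, z)`. -/
noncomputable def coordX (n p : ℕ) : PrimalSpace n p →L[ℝ] EuclideanSpace ℝ (Fin p) :=
  WithLp.fstL 2 ℝ _ _

/-- The coordinate `u` of `(x, u, z)`. -/
noncomputable def coordU (n p : ℕ) : PrimalSpace n p →L[ℝ] EuclideanSpace ℝ (Fin n) :=
  WithLp.fstL 2 ℝ _ _ ∘L WithLp.sndL 2 ℝ _ _

/-- The coordinate `z` of `(x, u, z)`. -/
noncomputable def coordZ (n p : ℕ) : PrimalSpace n p →L[ℝ] EuclideanSpace ℝ (Fin p) :=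
  WithLp.sndL 2 ℝ _ _ ∘L WithLp.sndL 2 ℝ _ _

/-- The objective as a function of the point `w = (x, u, z)`. -/
noncomputable def cost (w : PrimalSpace n p) : ℝ :=
  D.objective (coordX n p w) (coordU n p w) (coordZ n p w)

/-- The linear part `(x, u, z) ↦ (u + A x, z - x)` of the constraints. -/
noncomputable def constraintMap : PrimalSpace n p →L[ℝ] DualSpace n p :=
  (WithLp.prodContinuousLinearEquiv 2 ℝ _ _).symm.toContinuousLinearMap ∘L
    ((coordU n p + D.A ∘L coordX n p).prod (coordZ n p - coordX n p))

/-- The right-hand side `(b, 0)` of the constraints. -/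
def constraintRhs : DualSpace n p :=
  WithLp.toLp 2 (D.b, 0)

theorem residual_eq (w : PrimalSpace n p) :
    D.constraintMap w - D.constraintRhs =
      WithLp.toLp 2 (w.snd.fst - D.b + D.A w.fst, w.snd.snd - w.fst) := by
  have h1 : D.constraintMap w - D.constraintRhs =
      WithLp.toLp 2 (w.snd.fst + D.A w.fst - D.b, w.snd.snd - w.fst - 0) := rfl
  rw [h1, sub_zero, add_sub_right_comm]

theorem lagrangian_eq (w : PrimalSpace n p) (α : DualSpace n p) :
    D.lagrangian w.fst w.snd.fst w.snd.snd α =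
      linLagrangian D.cost D.constraintMap D.constraintRhs w α := by
  rw [linLagrangian, residual_eq, WithLp.prod_inner_apply]
  change _ = D.objective w.fst w.snd.fst w.snd.snd - _
  simp only [lagrangian, objective]
  change _ = _ - (⟪w.snd.fst - D.b + D.A w.fst, α.fst⟫_ℝ + ⟪w.snd.snd - w.fst, α.snd⟫_ℝ)
  ring

theorem augLagrangian_eq (ρ : ℝ) (w : PrimalSpace n p) (α : DualSpace n p) :
    D.augLagrangian ρ w.fst w.snd.fst w.snd.snd α =
      augLinLagrangian D.cost D.constraintMap D.constraintRhs ρ w α := by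
  rw [augLinLagrangian, ← lagrangian_eq, residual_eq, WithLp.prod_norm_sq_eq_of_L2]
  change _ = _ + ρ / 2 * (‖w.snd.fst - D.b + D.A w.fst‖ ^ 2 + ‖w.snd.snd - w.fst‖ ^ 2)
  simp only [lagrangian, augLagrangian]
  ring

theorem Tlagrangian_eq :
    D.Tlagrangian = saddleMap D.cost D.constraintMap D.constraintRhs := by
  funext q
  simp only [Tlagrangian, saddleMap, lagrangian_eq]

theorem neg_lagrangian_eq (x : EuclideanSpace ℝ (Fin p)) (u : EuclideanSpace ℝ (Fin n))
    (z : EuclideanSpace ℝ (Fin p)) (α : DualSpace n p) :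
    - D.lagrangian x u z α =
      (⟪D.A.adjoint α.fst - α.snd, x⟫_ℝ - 1 / (2 * D.sigma) * ‖x - D.xk‖ ^ 2 - ⟪D.b, α.fst⟫_ℝ)
        + (⟪α.fst, u⟫_ℝ - D.h u) + (⟪α.snd, z⟫_ℝ - D.f z) := by
  simp only [lagrangian, inner_add_left, inner_sub_left, ContinuousLinearMap.adjoint_inner_left]
  rw [real_inner_comm α.fst (D.A x), real_inner_comm α.fst u, real_inner_comm α.snd z,
    real_inner_comm α.snd x]
  ring

/-- The negative Lagrangian separates in `x`, `u` and `z`: the suprema over `u` and `z` are the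
conjugates, and the one over `x` is attained at `xk + σ (A* α₁ - α₂)`. -/
theorem phi_eq (hσ : 0 < D.sigma) :
    D.phi = negDual D.cost D.constraintMap D.constraintRhs := by
  funext α
  have hw : ∀ w, - linLagrangian D.cost D.constraintMap D.constraintRhs w α = _ := fun w => by
    rw [← lagrangian_eq, neg_lagrangian_eq]
  set s := D.A.adjoint α.fst - α.snd with hs
  set C : ℝ := D.sigma / 2 * ‖s‖ ^ 2 - ⟪D.b, α.fst⟫_ℝ + ⟪D.xk, s⟫_ℝ with hC
  apply le_antisymm
  · refine EReal.coe_add_iSup_add_iSup_le fun u z => ?_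
    refine le_trans (EReal.coe_le_coe_iff.2 (le_of_eq ?_))
      (neg_linLagrangian_le_negDual (primalPt (D.xk + D.sigma • s) u z) α)
    rw [hw]
    change _ = (⟪s, D.xk + D.sigma • s⟫_ℝ
        - 1 / (2 * D.sigma) * ‖D.xk + D.sigma • s - D.xk‖ ^ 2 - ⟪D.b, α.fst⟫_ℝ)
        + (⟪α.fst, u⟫_ℝ - D.h u) + (⟪α.snd, z⟫_ℝ - D.f z)
    rw [add_sub_cancel_left, norm_smul, Real.norm_eq_abs, mul_pow, sq_abs, inner_add_right,
      inner_smul_right, real_inner_self_eq_norm_sq, real_inner_comm D.xk s]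
    have : 1 / (2 * D.sigma) * (D.sigma ^ 2 * ‖s‖ ^ 2) = D.sigma / 2 * ‖s‖ ^ 2 := by
      field_simp
    rw [this]
    ring
  · refine iSup_le fun w => ?_
    rw [hw, EReal.coe_add, EReal.coe_add]
    refine add_le_add (add_le_add (EReal.coe_le_coe_iff.2 ?_) (coe_le_conjugateFun _ _ _))
      (coe_le_conjugateFun _ _ _)
    linarith [inner_sub_sq_le hσ s w.fst D.xk]

/-! ### Convexity and piecewise structure of the objective -/

theorem convexOn_f (hlam : 0 < D.lam) : ConvexOn ℝ Set.univ D.f := by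
  refine ⟨convex_univ, fun x _ y _ s t hs ht _ => ?_⟩
  simp only [f, smul_eq_mul]
  have h : ∑ i, |(s • x + t • y) i| ≤ s * ∑ i, |x i| + t * ∑ i, |y i| := by
    rw [Finset.mul_sum, Finset.mul_sum, ← Finset.sum_add_distrib]
    refine Finset.sum_le_sum fun i _ => (abs_add_le _ _).trans (le_of_eq ?_)
    simp [abs_mul, abs_of_nonneg hs, abs_of_nonneg ht]
  nlinarith [mul_le_mul_of_nonneg_left h hlam.le]

theorem isPiecewiseLinearQuadratic_f : IsPiecewiseLinearQuadratic D.f :=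
  (IsPiecewiseLinearQuadratic.sum Finset.univ fun i =>
    isPiecewiseLinearQuadratic_abs
      (EuclideanSpace.proj i : EuclideanSpace ℝ (Fin p) →L[ℝ] ℝ)).const_mul D.lam

theorem isPiecewiseLinearQuadratic_cost (h_plq : IsPiecewiseLinearQuadratic D.h) :
    IsPiecewiseLinearQuadratic D.cost :=
  ((h_plq.comp (coordU n p)).add (D.isPiecewiseLinearQuadratic_f.comp (coordZ n p))).add
    (((isPiecewiseLinearQuadratic_norm_sub_sq D.xk).const_mul _).comp (coordX n p))

theorem convexOn_h_add_f (h_convex : ConvexOn ℝ Set.univ D.h) (hlam : 0 < D.lam) :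
    ConvexOn ℝ Set.univ fun w => D.h (coordU n p w) + D.f (coordZ n p w) :=
  (h_convex.comp_linearMap (coordU n p).toLinearMap).add
    ((D.convexOn_f hlam).comp_linearMap (coordZ n p).toLinearMap)

theorem convexOn_cost (h_convex : ConvexOn ℝ Set.univ D.h) (hlam : 0 < D.lam)
    (hσ : 0 < D.sigma) : ConvexOn ℝ Set.univ D.cost :=
  (D.convexOn_h_add_f h_convex hlam).add
    (((convexOn_norm_sub_sq D.xk).comp_linearMap (coordX n p).toLinearMap).smul
      (by positivity : 0 ≤ 1 / (2 * D.sigma)))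

/-- The augmented Lagrangian attains its minimum. -/
theorem exists_isMin_aug (h_convex : ConvexOn ℝ Set.univ D.h) (hlam : 0 < D.lam)
    (hσ : 0 < D.sigma) (ρ : ℝ) (hρ : 0 < ρ) (α : DualSpace n p) :
    ∃ w, ∀ y, augLinLagrangian D.cost D.constraintMap D.constraintRhs ρ w α ≤
      augLinLagrangian D.cost D.constraintMap D.constraintRhs ρ y α := by
  let F : PrimalSpace n p → ℝ := fun w => D.h (coordU n p w) + D.f (coordZ n p w)
    + (- ⟪D.constraintMap w, α⟫_ℝ + ⟪D.constraintRhs, α⟫_ℝ)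
  have hF : ConvexOn ℝ Set.univ F := by
    refine (D.convexOn_h_add_f h_convex hlam).add
      (((LinearMap.convexOn (- (innerSL ℝ α ∘L D.constraintMap).toLinearMap)
        convex_univ).add_const ⟪D.constraintRhs, α⟫_ℝ).congr fun w _ => ?_)
    change - ⟪α, D.constraintMap w⟫_ℝ + _ = _
    rw [real_inner_comm]
  -- These weights merge the penalty and the proximal term into a single `‖T w - t‖ ^ 2`. `T` is
  -- injective because the proximal part determines `x`, and the constraints then determine `u` and
  -- `z`.
  let c₁ := √(ρ / 2)
  let c₂ := √(1 / (2 * D.sigma))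
  have hc₁ : 0 < c₁ := Real.sqrt_pos.2 (by positivity)
  have hc₂ : 0 < c₂ := Real.sqrt_pos.2 (by positivity)
  let T : PrimalSpace n p →L[ℝ] WithLp 2 (DualSpace n p × EuclideanSpace ℝ (Fin p)) :=
    (WithLp.prodContinuousLinearEquiv 2 ℝ _ _).symm.toContinuousLinearMap ∘L
      ((c₁ • D.constraintMap).prod (c₂ • coordX n p))
  let t : WithLp 2 (DualSpace n p × EuclideanSpace ℝ (Fin p)) :=
    WithLp.toLp 2 (c₁ • D.constraintRhs, c₂ • D.xk)
  have hT : Function.Injective T := by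
    rw [injective_iff_map_eq_zero]
    intro w hw
    have h1 : c₁ • D.constraintMap w = 0 := congrArg (fun q => q.fst) hw
    have h2 : c₂ • coordX n p w = 0 := congrArg (fun q => q.snd) hw
    rw [smul_eq_zero_iff_right hc₁.ne'] at h1
    rw [smul_eq_zero_iff_right hc₂.ne'] at h2
    have h3 : coordU n p w + D.A (coordX n p w) = 0 := congrArg (fun q => q.fst) h1
    have h4 : coordZ n p w - coordX n p w = 0 := congrArg (fun q => q.snd) h1
    rw [h2, map_zero, add_zero] at h3
    rw [h2, sub_zero] at h4
    change primalPt (coordX n p w) (coordU n p w) (coordZ n p w) = 0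
    rw [h2, h3, h4]
    rfl
  have hnorm : ∀ w, ‖T w - t‖ ^ 2 = ρ / 2 * ‖D.constraintMap w - D.constraintRhs‖ ^ 2
      + 1 / (2 * D.sigma) * ‖coordX n p w - D.xk‖ ^ 2 := by
    intro w
    have h : T w - t = WithLp.toLp 2 (c₁ • (D.constraintMap w - D.constraintRhs),
        c₂ • (coordX n p w - D.xk)) := by
      rw [smul_sub, smul_sub]; rfl
    rw [h, WithLp.prod_norm_sq_eq_of_L2]
    change ‖c₁ • (D.constraintMap w - D.constraintRhs)‖ ^ 2
      + ‖c₂ • (coordX n p w - D.xk)‖ ^ 2 = _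
    rw [norm_smul, norm_smul, mul_pow, mul_pow, Real.norm_eq_abs, Real.norm_eq_abs, sq_abs, sq_abs,
      Real.sq_sqrt (by positivity), Real.sq_sqrt (by positivity)]
  have haug : ∀ w, augLinLagrangian D.cost D.constraintMap D.constraintRhs ρ w α =
      F w + ‖T w - t‖ ^ 2 := by
    intro w
    rw [hnorm]
    simp only [augLinLagrangian, linLagrangian, cost, objective, F, inner_sub_left]
    ring
  simp only [haug]
  exact hF.exists_isMin_add_norm_sq T hT t

theorem exists_feasible : ∃ w, D.constraintMap w = D.constraintRhs := by
  refine ⟨primalPt 0 D.b 0, ?_⟩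
  rw [← sub_eq_zero, residual_eq]
  change WithLp.toLp 2 (D.b - D.b + D.A 0, (0 : EuclideanSpace ℝ (Fin p)) - 0) = 0
  rw [sub_self, sub_self, map_zero, add_zero]
  rfl

theorem constraintMap_eq_iff (w : PrimalSpace n p) :
    D.constraintMap w = D.constraintRhs ↔
      w.snd.fst = D.b - D.A w.fst ∧ w.snd.snd = w.fst := by
  rw [← sub_eq_zero, residual_eq]
  have h0 : (0 : DualSpace n p) = WithLp.toLp 2 (0, 0) := rfl
  rw [h0, (WithLp.toLp_injective 2).eq_iff, Prod.mk.injEq, sub_eq_zero, eq_sub_iff_add_eq,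
    ← sub_eq_zero (a := w.snd.fst + D.A w.fst), add_sub_right_comm]

theorem isOptimal_of_zero_mem {q : WithLp 2 (PrimalSpace n p × DualSpace n p)}
    (hq : 0 ∈ saddleMap D.cost D.constraintMap D.constraintRhs q) :
    D.IsOptimal q.fst.fst q.fst.snd.fst q.fst.snd.snd := by
  obtain ⟨h1, h2⟩ := zero_mem_saddleMap_iff.1 hq
  refine ⟨(D.constraintMap_eq_iff q.fst).1 h2, fun x' u' z' hu hz => ?_⟩
  have h3 := (D.constraintMap_eq_iff (primalPt x' u' z')).2 ⟨hu, hz⟩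
  have h4 := h1 (primalPt x' u' z')
  rw [linLagrangian, linLagrangian, h2, h3] at h4
  simp only [sub_self, inner_zero_left, sub_zero] at h4
  exact h4

/-- By the parallelogram identity for the proximal term, the midpoint of two solutions with
different `x` would be strictly better; `x` determines `u` and `z`. -/
theorem isOptimal_unique (h_convex : ConvexOn ℝ Set.univ D.h) (hlam : 0 < D.lam)
    (hσ : 0 < D.sigma) {x x' : EuclideanSpace ℝ (Fin p)} {u u' : EuclideanSpace ℝ (Fin n)}
    {z z' : EuclideanSpace ℝ (Fin p)} (h : D.IsOptimal x u z) (h' : D.IsOptimal x' u' z') :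
    x' = x ∧ u' = u ∧ z' = z := by
  obtain ⟨⟨rfl, rfl⟩, hmin⟩ := h
  obtain ⟨⟨rfl, rfl⟩, hmin'⟩ := h'
  suffices hx : z' = z by subst hx; exact ⟨rfl, rfl, rfl⟩
  let m := (1 / 2 : ℝ) • z + (1 / 2 : ℝ) • z'
  have hAm : D.b - D.A m = (1 / 2 : ℝ) • (D.b - D.A z) + (1 / 2 : ℝ) • (D.b - D.A z') := by
    simp only [m, map_add, map_smul]
    module
  have h1 := hmin m _ m rfl rfl
  have h2 := hmin' m _ m rfl rfl
  have h3 := h_convex.2 (Set.mem_univ (D.b - D.A z)) (Set.mem_univ (D.b - D.A z'))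
    (by norm_num : (0 : ℝ) ≤ 1 / 2) (by norm_num : (0 : ℝ) ≤ 1 / 2) (by norm_num)
  have h4 := (D.convexOn_f hlam).2 (Set.mem_univ z) (Set.mem_univ z')
    (by norm_num : (0 : ℝ) ≤ 1 / 2) (by norm_num : (0 : ℝ) ≤ 1 / 2) (by norm_num)
  rw [← hAm] at h3
  simp only [objective, smul_eq_mul] at h1 h2 h3 h4
  change D.f m ≤ _ at h4
  have h5 : ‖m - D.xk‖ ^ 2 + ‖(1 / 2 : ℝ) • (z' - z)‖ ^ 2 =
      1 / 2 * ‖z - D.xk‖ ^ 2 + 1 / 2 * ‖z' - D.xk‖ ^ 2 := by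
    have e1 : m - D.xk = (1 / 2 : ℝ) • ((z - D.xk) + (z' - D.xk)) := by
      simp only [m]; module
    have e2 : z' - z = (z' - D.xk) - (z - D.xk) := by abel
    rw [e1, e2, norm_smul, norm_smul, mul_pow, mul_pow, norm_add_sq_real, norm_sub_sq_real (z' - D.xk),
      real_inner_comm (z - D.xk)]
    norm_num
    ring
  have h6 : 1 / (2 * D.sigma) * ‖(1 / 2 : ℝ) • (z' - z)‖ ^ 2 ≤ 0 := by
    have := congrArg (fun r => 1 / (2 * D.sigma) * r) h5
    simp only [mul_add] at this
    linarith
  have h7 : ‖(1 / 2 : ℝ) • (z' - z)‖ ^ 2 ≤ 0 := by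
    by_contra hcon
    exact absurd h6 (not_le.2 (mul_pos (by positivity) (not_le.1 hcon)))
  have h8 : (1 / 2 : ℝ) • (z' - z) = 0 := by
    rw [← norm_eq_zero]
    exact pow_eq_zero_iff two_ne_zero |>.1 (le_antisymm h7 (sq_nonneg _))
  rw [smul_eq_zero_iff_right (by norm_num)] at h8
  exact sub_eq_zero.1 h8

end ProxSubproblem

/-! ### The iterates: gradient of the inner objective, residuals, inexact proximal steps. -/

namespace ProxSubproblem

variable {n p : ℕ} (D : ProxSubproblem n p)

/-- The right-hand side is the updated multiplier, so the proximal step for `u` makes it a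
subgradient of `h` at `u`. -/
theorem smul_f₁_sub {ρ : ℝ} (hρ : 0 < ρ) (α : DualSpace n p) (x : EuclideanSpace ℝ (Fin p))
    (u : EuclideanSpace ℝ (Fin n)) :
    ρ • (D.f₁ ρ α x - u) = α.fst - ρ • (u - D.b + D.A x) := by
  have h : ρ • ((1 / ρ) • α.fst) = α.fst := by
    rw [smul_smul, mul_one_div_cancel hρ.ne', one_smul]
  rw [f₁, smul_sub, smul_add, h]
  module

theorem smul_f₂_sub {ρ : ℝ} (hρ : 0 < ρ) (α : DualSpace n p)
    (x z : EuclideanSpace ℝ (Fin p)) :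
    ρ • (D.f₂ ρ α x - z) = α.snd - ρ • (z - x) := by
  have h : ρ • ((1 / ρ) • α.snd) = α.snd := by
    rw [smul_smul, mul_one_div_cancel hρ.ne', one_smul]
  rw [f₂, smul_sub, smul_add, h]
  module

/-- The gradient of the objective of the inner problem. -/
theorem hasGradientAt_innerObjective (h_convex : ConvexOn ℝ Set.univ D.h) (hlam : 0 < D.lam)
    {ρ : ℝ} (hρ : 0 < ρ) {α : DualSpace n p} {x z : EuclideanSpace ℝ (Fin p)}
    {u : EuclideanSpace ℝ (Fin n)} (hu : IsProx (fun y => 1 / ρ * D.h y) (D.f₁ ρ α x) u)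
    (hz : IsProx (fun y => 1 / ρ * D.f y) (D.f₂ ρ α x) z) :
    HasGradientAt (D.innerObjective ρ α)
      (- D.A.adjoint (α.fst - ρ • (u - D.b + D.A x)) + (α.snd - ρ • (z - x))
        + (1 / D.sigma) • (x - D.xk)) x := by
  have h1 := (hu.hasGradientAt_moreauEnvelope
    (h_convex.const_mul_of_pos (one_div_pos.2 hρ))).hasFDerivAt
  have h2 := (hz.hasGradientAt_moreauEnvelope
    ((D.convexOn_f hlam).const_mul_of_pos (one_div_pos.2 hρ))).hasFDerivAt
  have hf₁ : HasFDerivAt (D.f₁ ρ α) (- D.A) x :=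
    (D.A.hasFDerivAt.const_sub D.b).add_const _
  have hf₂ : HasFDerivAt (D.f₂ ρ α) (ContinuousLinearMap.id ℝ _) x :=
    (hasFDerivAt_id x).add_const _
  have h3 : HasFDerivAt (fun x => ‖x - D.xk‖ ^ 2) _ x :=
    ((hasFDerivAt_id x).sub_const D.xk).norm_sq
  have h := (((h1.comp x hf₁).const_mul ρ).add ((h2.comp x hf₂).const_mul ρ)).add
    (h3.const_mul (1 / (2 * D.sigma)))
  rw [hasGradientAt_iff_hasFDerivAt]
  refine h.congr_fderiv ?_
  ext v
  rw [← smul_f₁_sub D hρ, ← smul_f₂_sub D hρ]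
  simp only [add_apply, smul_apply, neg_apply, ContinuousLinearMap.comp_apply,
    InnerProductSpace.toDual_apply_apply, smul_eq_mul, map_neg,
    ContinuousLinearMap.id_apply, inner_add_left, inner_neg_left, map_smul, real_inner_smul_left,
    ContinuousLinearMap.adjoint_inner_left, innerSL_apply_apply, id_eq, nsmul_eq_mul,
    Nat.cast_ofNat]
  ring

/-- The iterates of the augmented Lagrangian method nearly solve the optimality system. -/
theorem mem_saddleMap_of_prox (h_convex : ConvexOn ℝ Set.univ D.h) (hlam : 0 < D.lam)
    (hσ : 0 < D.sigma) {ρ : ℝ} (hρ : 0 < ρ) {α : DualSpace n p} {x z : EuclideanSpace ℝ (Fin p)}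
    {u : EuclideanSpace ℝ (Fin n)} (hu : IsProx (fun y => 1 / ρ * D.h y) (D.f₁ ρ α x) u)
    (hz : IsProx (fun y => 1 / ρ * D.f y) (D.f₂ ρ α x) z) :
    (WithLp.toLp 2 (primalPt (gradient (D.innerObjective ρ α) x) 0 0,
      D.constraintMap (primalPt x u z) - D.constraintRhs) :
        WithLp 2 (PrimalSpace n p × DualSpace n p)) ∈
      saddleMap D.cost D.constraintMap D.constraintRhs (WithLp.toLp 2 (primalPt x u z,
        α - ρ • (D.constraintMap (primalPt x u z) - D.constraintRhs))) := by
  rw [(D.hasGradientAt_innerObjective h_convex hlam hρ hu hz).gradient, mem_saddleMap_iff]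
  refine ⟨fun y => ?_, rfl⟩
  -- The `u` and `z` components of the residual vanish because those proximal steps are exact; only
  -- the `x` component, the gradient of the inner objective, remains.
  have h1 := hu.scaled_subgradient h_convex hρ y.snd.fst
  have h2 := hz.scaled_subgradient (D.convexOn_f hlam) hρ y.snd.snd
  rw [smul_f₁_sub D hρ] at h1
  rw [smul_f₂_sub D hρ] at h2
  rw [← lagrangian_eq, ← lagrangian_eq, residual_eq]
  change D.lagrangian x u z (α - ρ • WithLp.toLp 2 (u - D.b + D.A x, z - x)) + _ ≤
    D.lagrangian y.fst y.snd.fst y.snd.snd (α - ρ • WithLp.toLp 2 (u - D.b + D.A x, z - x))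
  rw [WithLp.prod_inner_apply, WithLp.prod_inner_apply]
  have e1 : (α - ρ • (WithLp.toLp 2 (u - D.b + D.A x, z - x) : DualSpace n p)).fst =
    α.fst - ρ • (u - D.b + D.A x) := rfl
  have e2 : (α - ρ • (WithLp.toLp 2 (u - D.b + D.A x, z - x) : DualSpace n p)).snd =
    α.snd - ρ • (z - x) := rfl
  simp only [lagrangian, e1, e2]
  generalize α.fst - ρ • (u - D.b + D.A x) = a₁ at h1 ⊢
  generalize α.snd - ρ • (z - x) = a₂ at h2 ⊢
  change _ + (⟪- D.A.adjoint a₁ + a₂ + (1 / D.sigma) • (x - D.xk), y.fst - x⟫_ℝ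
    + (⟪(0 : EuclideanSpace ℝ (Fin n)), y.snd.fst - u⟫_ℝ
      + ⟪(0 : EuclideanSpace ℝ (Fin p)), y.snd.snd - z⟫_ℝ)) ≤ _
  have h3 : 1 / (2 * D.sigma) * ‖x - D.xk‖ ^ 2 + (1 / D.sigma) * ⟪x - D.xk, y.fst - x⟫_ℝ ≤
      1 / (2 * D.sigma) * ‖y.fst - D.xk‖ ^ 2 := by
    have e3 : y.fst - D.xk = (x - D.xk) + (y.fst - x) := by abel
    have e4 : 1 / D.sigma = 1 / (2 * D.sigma) * 2 := by field_simp
    have : 0 ≤ 1 / (2 * D.sigma) * ‖y.fst - x‖ ^ 2 := by positivity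
    rw [e3, norm_add_sq_real, e4]
    linarith
  simp only [inner_zero_left, inner_add_left, inner_sub_left, inner_sub_right, inner_neg_left,
    real_inner_smul_left, ContinuousLinearMap.adjoint_inner_left] at h1 h2 h3 ⊢
  rw [real_inner_comm a₁ y.snd.fst, real_inner_comm a₁ u, real_inner_comm a₁ (D.A y.fst),
    real_inner_comm a₁ (D.A x), real_inner_comm a₂ y.snd.snd, real_inner_comm a₂ z,
    real_inner_comm a₂ y.fst, real_inner_comm a₂ x]
  linarith

theorem norm_primalPt_zero (g : EuclideanSpace ℝ (Fin p)) :
    ‖(primalPt g 0 0 : PrimalSpace n p)‖ = ‖g‖ :=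
  WithLp.norm_toLp_fst 2 _ _ g

/-- The multipliers of the augmented Lagrangian method with criterion (D1) are an inexact proximal
point sequence for the dual. -/
theorem exists_isInexactProximalSequence (h_convex : ConvexOn ℝ Set.univ D.h) (hlam : 0 < D.lam)
    (hσ : 0 < D.sigma) {ρ κ : ℕ → ℝ} (hρ : ∀ j, 0 < ρ j) {x z : ℕ → EuclideanSpace ℝ (Fin p)}
    {u : ℕ → EuclideanSpace ℝ (Fin n)} {α : ℕ → DualSpace n p} (hALM : D.IsALMSequence ρ x u z α)
    (hD1 : D.StoppingD1 ρ x u z α κ) :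
    ∃ β, IsInexactProximalSequence D.Tphi ρ κ α β := by
  have hH := D.convexOn_cost h_convex hlam hσ
  -- The multiplier updated with an exact minimizer `w j` is the exact proximal point of the dual,
  -- to which the computed multiplier is compared.
  choose w hw using fun j => D.exists_isMin_aug h_convex hlam hσ (ρ j) (hρ j) (α j)
  refine ⟨fun j => α j - ρ j • (D.constraintMap (w j) - D.constraintRhs), hρ, hD1.nonneg,
    hD1.summable, fun j => ?_, fun j => ?_⟩
  · rw [sub_sub_cancel, smul_smul, one_div_mul_cancel (hρ j).ne', one_smul, Tphi, phi_eq D hσ]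
    exact mem_subdifferential_negDual_of_isMin (linLagrangian_le_of_isMin_aug hH (hw j))
  · have hα : α (j + 1) = α j - ρ j • (D.constraintMap (primalPt (x (j + 1)) (u (j + 1))
        (z (j + 1))) - D.constraintRhs) := by
      rw [hALM.α_step j, residual_eq]; rfl
    have hinf : (⨅ y : PrimalSpace n p, D.augLagrangian (ρ j) y.fst y.snd.fst y.snd.snd (α j)) =
        augLinLagrangian D.cost D.constraintMap D.constraintRhs (ρ j) (w j) (α j) := by
      simp only [augLagrangian_eq]
      exact le_antisymm (ciInf_le ⟨_, by rintro _ ⟨y, rfl⟩; exact hw j y⟩ _) (le_ciInf (hw j))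
    have h1 := hD1.bound j
    rw [hinf] at h1
    have h2 := norm_sub_sq_le_of_isMin_aug hH (hρ j) (hw j)
      (primalPt (x (j + 1)) (u (j + 1)) (z (j + 1)))
    rw [← hα, ← augLagrangian_eq] at h2
    refine le_of_pow_le_pow_left₀ two_ne_zero
      (mul_nonneg (hD1.nonneg j) (norm_nonneg _)) (h2.trans ?_)
    refine (mul_le_mul_of_nonneg_left h1 (by linarith [hρ j])).trans (le_of_eq ?_)
    have := (hρ j).ne'
    field_simp

end ProxSubproblem

/-! ### Limits of the penalty parameters and of the rates. -/

section Limits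

theorem exists_pos_eventually_le {ρ : ℕ → ℝ} {ρinf : ℝ≥0∞} (hρinf : 0 < ρinf)
    (hlim : Tendsto (fun j => ENNReal.ofReal (ρ j)) atTop (𝓝 ρinf)) :
    ∃ δ : ℝ, 0 < δ ∧ ∀ᶠ j in atTop, δ ≤ ρ j := by
  obtain ⟨δ, h0, hδ⟩ := ENNReal.lt_iff_exists_nnreal_btwn.1 hρinf
  refine ⟨δ, by exact_mod_cast h0, ?_⟩
  filter_upwards [hlim.eventually_const_lt hδ] with j hj
  rw [← ENNReal.ofReal_coe_nnreal] at hj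
  exact ((ENNReal.ofReal_lt_ofReal_iff_of_nonneg δ.2).1 hj).le

theorem tendsto_toReal_of_ne_top {ρ : ℕ → ℝ} {ρinf : ℝ≥0∞} (hpos : ∀ j, 0 < ρ j)
    (hlim : Tendsto (fun j => ENNReal.ofReal (ρ j)) atTop (𝓝 ρinf)) (h : ρinf ≠ ⊤) :
    Tendsto ρ atTop (𝓝 ρinf.toReal) :=
  ((ENNReal.tendsto_toReal h).comp hlim).congr fun j => ENNReal.toReal_ofReal (hpos j).le

theorem tendsto_theta {ρ κ : ℕ → ℝ} {ρinf : ℝ≥0∞} (hpos : ∀ j, 0 < ρ j) (hρinf : 0 < ρinf)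
    (hlim : Tendsto (fun j => ENNReal.ofReal (ρ j)) atTop (𝓝 ρinf)) (hκ : Tendsto κ atTop (𝓝 0))
    (a : ℝ) :
    Tendsto (fun j => a / √(a ^ 2 + ρ j ^ 2) + 2 * κ j / (1 - κ j)) atTop
      (𝓝 (thetaLimit a ρinf)) := by
  have h1 : Tendsto (fun j => 2 * κ j / (1 - κ j)) atTop (𝓝 0) := by
    have := (hκ.const_mul 2).div (hκ.const_sub 1) (by norm_num)
    rwa [mul_zero, zero_div] at this
  rw [← add_zero (thetaLimit a ρinf)]
  refine Tendsto.add ?_ h1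
  unfold thetaLimit
  split_ifs with h
  · subst h
    have hρ : Tendsto ρ atTop atTop := ENNReal.tendsto_ofReal_nhds_top.1 hlim
    refine Tendsto.div_atTop tendsto_const_nhds (tendsto_atTop_mono (fun j => ?_) hρ)
    exact Real.le_sqrt_of_sq_le (by linarith [sq_nonneg a])
  · have hρ := tendsto_toReal_of_ne_top hpos hlim h
    have hr : 0 < ρinf.toReal := ENNReal.toReal_pos hρinf.ne' h
    refine Tendsto.div tendsto_const_nhds ?_ (by positivity)
    exact (Real.continuous_sqrt.tendsto _).comp ((hρ.pow 2).const_add _)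

theorem thetaLimit_lt_one {a : ℝ} {ρinf : ℝ≥0∞} (hρinf : 0 < ρinf) : thetaLimit a ρinf < 1 := by
  unfold thetaLimit
  split_ifs with h
  · exact one_pos
  · have hr : 0 < ρinf.toReal := ENNReal.toReal_pos hρinf.ne' h
    rw [div_lt_one (by positivity)]
    exact Real.lt_sqrt_of_sq_lt (by linarith [pow_pos hr 2])

theorem tendsto_thetaPrime {ρ κ' : ℕ → ℝ} {ρinf : ℝ≥0∞} (hpos : ∀ j, 0 < ρ j) (hρinf : 0 < ρinf)
    (hlim : Tendsto (fun j => ENNReal.ofReal (ρ j)) atTop (𝓝 ρinf))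
    (hκ' : Tendsto κ' atTop (𝓝 0)) (a : ℝ) :
    Tendsto (fun j => a * (1 + κ' j) / ρ j) atTop (𝓝 (thetaPrimeLimit a ρinf)) := by
  have h1 : Tendsto (fun j => a * (1 + κ' j)) atTop (𝓝 a) := by
    simpa using (hκ'.const_add 1).const_mul a
  unfold thetaPrimeLimit
  split_ifs with h
  · subst h
    exact h1.div_atTop (ENNReal.tendsto_ofReal_nhds_top.1 hlim)
  · exact h1.div (tendsto_toReal_of_ne_top hpos hlim h) (ENNReal.toReal_pos hρinf.ne' h).ne'

end Limits

/-! ### Primal estimate under (D2). -/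

namespace ProxSubproblem

variable {n p : ℕ} (D : ProxSubproblem n p)

/-- Because of this, the distance to the set of saddle points bounds the distance of the primal part
to the one solution. -/
theorem fst_eq_of_zero_mem (h_convex : ConvexOn ℝ Set.univ D.h) (hlam : 0 < D.lam)
    (hσ : 0 < D.sigma) {q q' : WithLp 2 (PrimalSpace n p × DualSpace n p)}
    (hq : 0 ∈ saddleMap D.cost D.constraintMap D.constraintRhs q)
    (hq' : 0 ∈ saddleMap D.cost D.constraintMap D.constraintRhs q') : q'.fst = q.fst := by
  obtain ⟨e1, e2, e3⟩ := D.isOptimal_unique h_convex hlam hσ (D.isOptimal_of_zero_mem hq)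
    (D.isOptimal_of_zero_mem hq')
  have h : ∀ w : PrimalSpace n p, w = primalPt w.fst w.snd.fst w.snd.snd := fun w => rfl
  rw [h q'.fst, h q.fst, e1, e2, e3]

/-- The asymptotic bound on the distance of the primal iterates to the solution. -/
theorem eventually_norm_primal_le (h_convex : ConvexOn ℝ Set.univ D.h) (hlam : 0 < D.lam)
    (hσ : 0 < D.sigma) {ρ κ' : ℕ → ℝ} (hρ : ∀ j, 0 < ρ j) {x z : ℕ → EuclideanSpace ℝ (Fin p)}
    {u : ℕ → EuclideanSpace ℝ (Fin n)} {α : ℕ → DualSpace n p} (hALM : D.IsALMSequence ρ x u z α)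
    (hD2 : D.StoppingD2 ρ x α κ') {δ : ℝ} (hδ : 0 < δ) (hδρ : ∀ᶠ j in atTop, δ ≤ ρ j)
    {αstar : DualSpace n p} (hα : Tendsto α atTop (𝓝 αstar))
    {q₀ : WithLp 2 (PrimalSpace n p × DualSpace n p)}
    (hq₀ : 0 ∈ saddleMap D.cost D.constraintMap D.constraintRhs q₀) {a : ℝ}
    (ha : HasErrorBoundAtOrigin D.Tlagrangian a) :
    ∀ᶠ j in atTop, ‖primalPt (x (j + 1)) (u (j + 1)) (z (j + 1)) - q₀.fst‖ ≤
      a * (1 + κ' j) / ρ j * ‖α (j + 1) - α j‖ := by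
  have ha0 := ha.1
  rw [Tlagrangian_eq] at ha
  obtain ⟨ε, hε, hbound⟩ := ha.exists_infDist_le
  have hdiff : Tendsto (fun j => ‖α (j + 1) - α j‖) atTop (𝓝 0) := by
    simpa using (((tendsto_add_atTop_iff_nat 1).2 hα).sub hα).norm
  filter_upwards [hδρ, hD2.tendsto_zero.eventually_le_const one_pos,
    hdiff.eventually_lt_const (by positivity : 0 < ε * δ / 2)] with j hj1 hj2 hj3
  have hmem := D.mem_saddleMap_of_prox h_convex hlam hσ (hρ j) (hALM.u_step j) (hALM.z_step j)
  set w := primalPt (x (j + 1)) (u (j + 1)) (z (j + 1)) with hw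
  have hαj : α (j + 1) = α j - ρ j • (D.constraintMap w - D.constraintRhs) := by
    rw [hALM.α_step j, residual_eq]; rfl
  have hres : ‖D.constraintMap w - D.constraintRhs‖ = 1 / ρ j * ‖α (j + 1) - α j‖ := by
    have h1 : α (j + 1) - α j = - (ρ j • (D.constraintMap w - D.constraintRhs)) := by
      rw [hαj]; abel
    rw [h1, norm_neg, norm_smul, Real.norm_eq_abs, abs_of_pos (hρ j), ← mul_assoc,
      one_div_mul_cancel (hρ j).ne', one_mul]
  rw [← hαj] at hmem
  have hnorm := norm_toLp_le
    (primalPt (n := n) (gradient (D.innerObjective (ρ j) (α j)) (x (j + 1))) 0 0)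
    (D.constraintMap w - D.constraintRhs)
  rw [norm_primalPt_zero, hres] at hnorm
  have hnorm' := hnorm.trans (add_le_add_left (hD2.bound j) _)
  have hsum : κ' j / ρ j * ‖α (j + 1) - α j‖ + 1 / ρ j * ‖α (j + 1) - α j‖ =
      (1 + κ' j) / ρ j * ‖α (j + 1) - α j‖ := by ring
  rw [hsum] at hnorm'
  -- Eventually `κ' j ≤ 1` and `ρ j ≥ δ`, so the factor is at most `2 / δ`; hence the threshold `ε *
  -- δ / 2` for the step.
  have hsmall : (1 + κ' j) / ρ j * ‖α (j + 1) - α j‖ < ε := by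
    have h1 : (1 + κ' j) / ρ j ≤ 2 / δ := by
      have := hD2.nonneg j
      exact div_le_div₀ zero_le_two (by linarith) hδ hj1
    calc _ ≤ 2 / δ * ‖α (j + 1) - α j‖ := mul_le_mul_of_nonneg_right h1 (norm_nonneg _)
      _ < 2 / δ * (ε * δ / 2) := mul_lt_mul_of_pos_left hj3 (by positivity)
      _ = ε := by field_simp
  have hdist := hbound _ _ hmem (hnorm'.trans_lt hsmall)
  have hfinal : ‖w - q₀.fst‖ ≤ Metric.infDist (WithLp.toLp 2 (w, α (j + 1)))
      {q | 0 ∈ saddleMap D.cost D.constraintMap D.constraintRhs q} := by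
    refine (Metric.le_infDist ⟨q₀, hq₀⟩).2 fun {q} hq => ?_
    rw [dist_eq_norm, ← D.fst_eq_of_zero_mem h_convex hlam hσ hq₀ (q' := q) hq]
    exact WithLp.norm_fst_le _ (WithLp.toLp 2 (w, α (j + 1)) - q)
  calc _ ≤ _ := hfinal
    _ ≤ _ := hdist
    _ ≤ a * ((1 + κ' j) / ρ j * ‖α (j + 1) - α j‖) := mul_le_mul_of_nonneg_left hnorm' ha0
    _ = _ := by ring

end ProxSubproblem

/-! ### Assembly of the theorem. -/

theorem mainTheorem4 {n p : ℕ} (D : ProxSubproblem n p)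
    (h_convex : ConvexOn ℝ Set.univ D.h)
    (h_plq : IsPiecewiseLinearQuadratic D.h)
    (hlam : 0 < D.lam) (hsigma : 0 < D.sigma)
    (ρ : ℕ → ℝ) (ρinf : ℝ≥0∞)
    (hρ_pos : ∀ j, 0 < ρ j) (hρinf_pos : 0 < ρinf)
    (hρ_lim : Tendsto (fun j => ENNReal.ofReal (ρ j)) atTop (𝓝 ρinf))
    (x : ℕ → EuclideanSpace ℝ (Fin p)) (u : ℕ → EuclideanSpace ℝ (Fin n))
    (z : ℕ → EuclideanSpace ℝ (Fin p)) (α : ℕ → DualSpace n p)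
    (hALM : D.IsALMSequence ρ x u z α)
    (κ : ℕ → ℝ) (hD1 : D.StoppingD1 ρ x u z α κ) :
    -- the error bound conditions hold, with some moduli
    (∃ aφ : ℝ, HasErrorBoundAtOrigin D.Tphi aφ) ∧
    (∃ aL : ℝ, HasErrorBoundAtOrigin D.Tlagrangian aL) ∧
    -- (i)
    (∃ αstar ∈ D.dualSolutions, Tendsto α atTop (𝓝 αstar)) ∧
    (∀ aφ : ℝ, HasErrorBoundAtOrigin D.Tphi aφ →
      (∀ᶠ j in atTop,
        Metric.infDist (α (j + 1)) D.dualSolutions ≤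
          (aφ / √(aφ ^ 2 + ρ j ^ 2) + 2 * κ j / (1 - κ j)) *
            Metric.infDist (α j) D.dualSolutions) ∧
      Tendsto (fun j => aφ / √(aφ ^ 2 + ρ j ^ 2) + 2 * κ j / (1 - κ j)) atTop
        (𝓝 (thetaLimit aφ ρinf)) ∧
      thetaLimit aφ ρinf < 1) ∧
    -- (ii)
    (∃ (xstar : EuclideanSpace ℝ (Fin p)) (ustar : EuclideanSpace ℝ (Fin n))
        (zstar : EuclideanSpace ℝ (Fin p)),
      D.IsOptimal xstar ustar zstar ∧
      (∀ x' u' z', D.IsOptimal x' u' z' → x' = xstar ∧ u' = ustar ∧ z' = zstar) ∧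
      ∀ κ' : ℕ → ℝ, D.StoppingD2 ρ x α κ' →
        ∀ aL : ℝ, HasErrorBoundAtOrigin D.Tlagrangian aL →
          (∀ᶠ j in atTop,
            ‖primalPt (x (j + 1)) (u (j + 1)) (z (j + 1)) - primalPt xstar ustar zstar‖ ≤
              aL * (1 + κ' j) / ρ j * ‖α (j + 1) - α j‖) ∧
          Tendsto (fun j => aL * (1 + κ' j) / ρ j) atTop (𝓝 (thetaPrimeLimit aL ρinf))) := by
  have hH := D.convexOn_cost h_convex hlam hsigma
  have hattain := D.exists_isMin_aug h_convex hlam hsigma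
  obtain ⟨a, ε, ha, hε, hlip⟩ := exists_upper_lipschitz_saddleMap (B := D.constraintMap)
    (b := D.constraintRhs) hH (D.isPiecewiseLinearQuadratic_cost h_plq)
  obtain ⟨q₀, hq₀⟩ := exists_saddle_point hH hattain D.exists_feasible hε hlip
  have hTphi : D.Tphi = subdifferential (negDual D.cost D.constraintMap D.constraintRhs) := by
    funext α; rw [ProxSubproblem.Tphi, D.phi_eq hsigma]
  have hEBphi : HasErrorBoundAtOrigin D.Tphi (a + 1) := by
    rw [hTphi]
    exact hasErrorBoundAtOrigin_of_upper_lipschitz ha hε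
      (upper_lipschitz_negDual hH hattain hlip)
  have hω : 0 ∈ D.Tphi q₀.snd := by
    obtain ⟨h1, h2⟩ := zero_mem_saddleMap_iff.1 hq₀
    have := mem_subdifferential_negDual_of_isMin h1
    rwa [h2, sub_self, ← hTphi] at this
  have hΩ : D.dualSolutions = {β | 0 ∈ D.Tphi β} := by
    ext β
    simp only [ProxSubproblem.dualSolutions, Set.mem_ofPred_eq, hTphi, D.phi_eq hsigma]
    rw [hTphi] at hω
    exact neg_negDual_le_iff hω.1
  have hclosed : IsClosed {β | 0 ∈ D.Tphi β} := by
    rw [hTphi]; exact isClosed_zeros_subdifferential_negDual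
  have hmono : ∀ x y v w, v ∈ D.Tphi x → w ∈ D.Tphi y → 0 ≤ ⟪v - w, x - y⟫_ℝ := by
    rw [hTphi]; exact fun x y v w hv hw => subdifferential_negDual_monotone hv hw
  obtain ⟨β, hβ⟩ := D.exists_isInexactProximalSequence h_convex hlam hsigma hρ_pos hALM hD1
  obtain ⟨δ, hδ, hδρ⟩ := exists_pos_eventually_le hρinf_pos hρ_lim
  -- Convergence needs only some modulus, and `a + 1` serves; the rates below are then proved for
  -- every admissible modulus.
  obtain ⟨αstar, hαstar, hconv⟩ := hβ.exists_tendsto hmono hEBphi hδ hδρ hclosed hω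
  refine ⟨⟨_, hEBphi⟩, ⟨a + 1, ?_⟩, ⟨αstar, hΩ ▸ hαstar, hconv⟩, fun aφ haφ => ?_, ?_⟩
  · rw [D.Tlagrangian_eq]
    exact hasErrorBoundAtOrigin_of_upper_lipschitz ha hε hlip
  · rw [hΩ]
    exact ⟨hβ.eventually_infDist_le hmono haφ hδ hδρ hclosed hω,
      tendsto_theta hρ_pos hρinf_pos hρ_lim hD1.summable.tendsto_atTop_zero aφ,
      thetaLimit_lt_one hρinf_pos⟩
  · have hopt := D.isOptimal_of_zero_mem hq₀
    refine ⟨_, _, _, hopt, fun x' u' z' h' => D.isOptimal_unique h_convex hlam hsigma hopt h',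
      fun κ' hD2 aL haL => ⟨?_, tendsto_thetaPrime hρ_pos hρinf_pos hρ_lim hD2.tendsto_zero aL⟩⟩
    exact D.eventually_norm_primal_le h_convex hlam hsigma hρ_pos hALM hD2 hδ hδρ hconv hq₀ haL
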